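/- \textbf{Conventions.} Let $(X,d)$ be a geodesic metric space and $\mathcal P$ a collection of subsets of $X$. For $A\subseteq X$ put $N_K(A)=\{x\in X : d(x,A)\le K\}$ (with $d(x,\emptyset)=\infty$), and let $B_K(x)$ be the ball of radius $K$ around $x$. A $(1,C)$-almost-geodesic from $x$ to $y$ is a continuous map $\beta:[a,b]\to X$ ($a\le b$) with $\beta(a)=x$, $\beta(b)=y$ and $|s-t|-C\le d(\beta(s),\beta(t))\le |s-t|+C$ for all $s,t\in[a,b]$. \begin{itemize} \item $(\alpha_1)$: for each $K$ there exists $B$ such that $\operatorname{diam}(N_K(P)\cap N_K(Q))\le B$ for all distinct $P,Q\in\mathcal P$. \item $(\alpha_2)$: there exist $\epsilon\in(0,1/2)$ and $M\ge 0$ such that for every $P\in\mathcal P$ and all $x,y\in N_{\epsilon d(x,y)}(P)$, any geodesic from $x$ to $y$ intersects $N_M(P)$. \item $X$ is $(*)$-asymptotically tree-graded with respect to $\mathcal P$ if for every $C\ge 0$ there exist $\sigma,\delta\ge 0$ such that for every triangle with vertices $v_1,v_2,v_3$ whose sides $\gamma_i$ are $(1,C)$-almost-geodesics from $v_i$ to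 $v_{i+1}$ (indices mod $3$), either some ball of radius $\sigma$ intersects all three sides, or there is $P\in\mathcal P$ such that $N_\sigma(P)$ intersects all three sides and the first point $x_i$ and the last point $y_i$ of $\gamma_i$ in $N_\sigma(P)$ satisfy $d(y_i,x_{i+1})\le\delta$ for each $i$ mod $3$. \item $X$ is hyperbolic relative to $\mathcal P$ if $\mathcal P$ satisfies $(\alpha_1)$ and $(\alpha_2)$ and $X$ is $(*)$-asymptotically tree-graded with respect to $\mathcal P$. \item For a path $\beta$ in $X$, a point $p\in\beta$ lies in $deep_{\mu,c}(\beta)$ if there are $P\in\mathcal P$ and a subpath $\beta'$ of $\beta$ containing $p$, with endpoints $x_1,x_2\in N_\mu(P)$, such that $d(p,x_1)>c$ and $d(p,x_2)>c$. Put $trans_{\mu,c}(\beta)=\beta\setminus deep_{\mu,c}(\beta)$. \end{itemize} \textbf{Theorem (Guessing Geodesics Lemma).} Let $(X,d)$ be a geodesic metric space and $\mathcal P$ a collection of subsets of $X$. Suppose that to each pair of points $x,y\in X$ are assigned a path $\eta(x,y)$ from $x$ to $y$ and a closed subset $trans(x,y)\subseteq\eta(x,y)$, so that for some constant $D$ the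 following hold, where $\eta(x,y)|_{[x',y']}$ denotes the subpath of $\eta(x,y)$ between the points $x',y'\in\eta(x,y)$ (points of a path are given by parameters, and $x',y'$ may occur in either order): \begin{enumerate} \item if $d(x,y)\le 2$ then $\operatorname{diam}(trans(x,y))\le D$; \item for all $x',y'\in\eta(x,y)$, the Hausdorff distance between $trans(x',y')$ and $\bigl(trans(x,y)\cap\eta(x,y)|_{[x',y']}\bigr)\cup\{x',y'\}$ is at most $D$; \item $trans(x,y)\subseteq N_D(trans(x,z)\cup trans(z,y))$ for all $x,y,z\in X$; \item if $x',y'\in\eta(x,y)$ do not both lie on $P$ for any $P\in\mathcal P$, then there exists $z\in trans(x,y)\cap\eta(x,y)|_{[x',y']}$; \item $(\alpha_1)$ holds; \item for every $k$ there exists $K$ such that for all $P\in\mathcal P$ and $x,y\in X$ with $d(x,P),d(y,P)\le k$ and $d(x,y)\ge K$, we have $trans(x,y)\subseteq B_K(x)\cup B_K(y)$ and there exists $z\in trans(x,y)\cap N_D(P)$. \end{enumerate} Then \begin{enumerate} \item[(a)] $X$ is hyperbolic relative to $\mathcal P$; \item[(b)] for every $C$ there exist $\mu,c_0,L\ge 0$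 such that for every $c\ge c_0$ and every $(1,C)$-almost-geodesic $\beta$ from $x$ to $y$, the Hausdorff distance between $trans(x,y)$ and $trans_{\mu,c}(\beta)$ is at most $L+c$. \end{enumerate} -/

import Mathlib

open Set Metric

/-- `γ`, restricted to `[a, b]`, is an `(l, C)`-almost-geodesic from `x` to `y`: a continuous
`(l, C)`-quasi-geodesic. Values of `γ` outside `[a, b]` are irrelevant. -/
structure IsAlmostGeodesic {X : Type*} [MetricSpace X] (l C : ℝ) (γ : ℝ → X) (a b : ℝ)
    (x y : X) : Prop where
  le : a ≤ b
  source : γ a = x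
  target : γ b = y
  continuousOn : ContinuousOn γ (Icc a b)
  lower : ∀ s ∈ Icc a b, ∀ t ∈ Icc a b, l⁻¹ * |s - t| - C ≤ dist (γ s) (γ t)
  upper : ∀ s ∈ Icc a b, ∀ t ∈ Icc a b, dist (γ s) (γ t) ≤ l * |s - t| + C

/-- `γ`, restricted to `[0, dist x y]`, is a geodesic from `x` to `y`. -/
structure IsGeodesic {X : Type*} [MetricSpace X] (γ : ℝ → X) (x y : X) : Prop where
  source : γ 0 = x
  target : γ (dist x y) = y
  isometric : ∀ s ∈ Icc 0 (dist x y), ∀ t ∈ Icc 0 (dist x y), dist (γ s) (γ t) = |s - t|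

/-- Any two points are joined by a geodesic. -/
def IsGeodesicSpace (X : Type*) [MetricSpace X] : Prop :=
  ∀ x y : X, ∃ γ : ℝ → X, IsGeodesic γ x y

/-! The closed neighbourhood `{x | d(x, A) ≤ K}` of `A` is `Metric.cthickening K A`
(it is empty if `A` is empty, the distance to the empty set being infinite). -/

/-- Property `(α₁)`: neighbourhoods of distinct peripheral sets have uniformly bounded
intersections. -/
def AlphaOne {X : Type*} [MetricSpace X] (Ps : Set (Set X)) : Prop :=
  ∀ K : ℝ, ∃ B : ℝ, ∀ P ∈ Ps, ∀ Q ∈ Ps, P ≠ Q →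
    ediam (cthickening K P ∩ cthickening K Q) ≤ ENNReal.ofReal B

/-- Property `(α₂)`. -/
def AlphaTwo {X : Type*} [MetricSpace X] (Ps : Set (Set X)) : Prop :=
  ∃ ε : ℝ, 0 < ε ∧ ε < 1 / 2 ∧ ∃ M : ℝ, 0 ≤ M ∧ ∀ P ∈ Ps, ∀ x y : X,
    x ∈ cthickening (ε * dist x y) P → y ∈ cthickening (ε * dist x y) P →
    ∀ γ : ℝ → X, IsGeodesic γ x y → ∃ t ∈ Icc 0 (dist x y), γ t ∈ cthickening M P

/-- `s` is the parameter of the entrance point of `γ|[a, b]` in `S`. -/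
def IsEntrance {X : Type*} (γ : ℝ → X) (a b : ℝ) (S : Set X) (s : ℝ) : Prop :=
  IsLeast {t | t ∈ Icc a b ∧ γ t ∈ S} s

/-- `s` is the parameter of the exit point of `γ|[a, b]` from `S`. -/
def IsExit {X : Type*} (γ : ℝ → X) (a b : ℝ) (S : Set X) (s : ℝ) : Prop :=
  IsGreatest {t | t ∈ Icc a b ∧ γ t ∈ S} s

/-- `X` is `(*)`-asymptotically tree-graded with respect to `Ps`. A triangle has vertices `v 0`,
`v 1`, `v 2` and its side `γ i` goes from `v i` to `v (i + 1)`, indices modulo `3`. -/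
def IsStarAsympTreeGraded {X : Type*} [MetricSpace X] (Ps : Set (Set X)) : Prop :=
  ∀ C : ℝ, 0 ≤ C → ∃ σ δ : ℝ, 0 ≤ σ ∧ 0 ≤ δ ∧
    ∀ (v : Fin 3 → X) (γ : Fin 3 → ℝ → X) (a b : Fin 3 → ℝ),
      (∀ i, IsAlmostGeodesic 1 C (γ i) (a i) (b i) (v i) (v (i + 1))) →
      (∃ p : X, ∀ i, ∃ t ∈ Icc (a i) (b i), γ i t ∈ closedBall p σ) ∨
      (∃ P ∈ Ps, ∃ ent ext : Fin 3 → ℝ,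
        (∀ i, IsEntrance (γ i) (a i) (b i) (cthickening σ P) (ent i)) ∧
        (∀ i, IsExit (γ i) (a i) (b i) (cthickening σ P) (ext i)) ∧
        ∀ i, dist (γ i (ext i)) (γ (i + 1) (ent (i + 1))) ≤ δ)

/-- The geodesic metric space `X` is hyperbolic relative to the collection `Ps`. -/
structure IsHyperbolicRelative (X : Type*) [MetricSpace X] (Ps : Set (Set X)) : Prop where
  geodesic : IsGeodesicSpace X
  alphaOne : AlphaOne Ps
  alphaTwo : AlphaTwo Ps
  treeGraded : IsStarAsympTreeGraded Ps

/-- The `(μ, c)`-deep points of the path `γ|[a, b]`: points `p = γ t` of a subpath `γ|[s, u]`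
whose two endpoints lie in the `μ`-neighbourhood of one peripheral set, at distance more than `c`
from `p`. -/
def deepSet {X : Type*} [MetricSpace X] (Ps : Set (Set X)) (μ c : ℝ) (γ : ℝ → X) (a b : ℝ) :
    Set X :=
  {p | ∃ P ∈ Ps, ∃ s t u : ℝ, a ≤ s ∧ s ≤ t ∧ t ≤ u ∧ u ≤ b ∧ γ t = p ∧
    γ s ∈ cthickening μ P ∧ γ u ∈ cthickening μ P ∧ c < dist p (γ s) ∧ c < dist p (γ u)}

/-- The `(μ, c)`-transient points of the path `γ|[a, b]`: its points that are not deep. -/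
def transientSet {X : Type*} [MetricSpace X] (Ps : Set (Set X)) (μ c : ℝ) (γ : ℝ → X) (a b : ℝ) :
    Set X :=
  γ '' Icc a b \ deepSet Ps μ c γ a b

/-! Transient sets behave like geodesics of a hyperbolic space, except that they may jump along
peripheral sets. Two tools express this. Thin triangles give polygons with `n` sides thinness of
order `log n` (`chain`). Condition 4 replaces connectedness: if two closed sets cover `tr x y` and
each contains one endpoint, then they meet, or one peripheral set comes near both (`exists_gap`).

For `q ∈ P`, the entrance point of `η x q` in a neighbourhood of `P` is close to `tr x v` for all
`v` near `P` (`exists_dist_entrance_le`). This yields a coarse projection to `P` which sends the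
ends of a transient set avoiding `P` to nearby points (`exists_contraction`).

The heart is a Morse lemma, `exists_dist_almostGeodesic_le`: `tr x y` is uniformly close to every
almost-geodesic `β` with the same ends. Let `p` be a transient point at maximal distance `R` from
`β`. A detour of size `O(R)` through `β` avoids the ball of radius `R / 2` around `p`, up to
logarithmic errors, which contradicts thinness if `R` is large. If the guessed path jumps along some
`P`, it may offer no transient point from which to start the detour; contraction then forces `β` to
follow `P` (`exists_return`), which provides one (`exists_bypass`).

Both conclusions then follow by applying the gap principle to suitable covers of `tr x y`, and the
projection to entrance points. -/

/-- `x` is at distance at most `k` from some point of `P`. -/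
def IsNear {X : Type*} [MetricSpace X] (k : ℝ) (P : Set X) (x : X) : Prop :=
  ∃ p ∈ P, dist x p ≤ k

section IsNear

variable {X : Type*} [MetricSpace X] {P : Set X} {k l r : ℝ} {x y : X}

theorem IsNear.of_dist_le (h : IsNear k P x) (hd : dist y x ≤ r) (hl : r + k ≤ l) :
    IsNear l P y := by
  obtain ⟨p, hp, hxp⟩ := h
  exact ⟨p, hp, by linarith [dist_triangle y x p]⟩

theorem IsNear.mono (h : IsNear k P x) (hl : k ≤ l) : IsNear l P x := by
  obtain ⟨p, hp, hxp⟩ := h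
  exact ⟨p, hp, by linarith⟩

theorem IsNear.mem_cthickening (h : IsNear k P x) (hl : k ≤ l) : x ∈ cthickening l P := by
  obtain ⟨p, hp, hxp⟩ := h
  exact mem_cthickening_of_dist_le x p l P hp (by linarith)

theorem isNear_of_mem_cthickening (h : x ∈ cthickening k P) (h0 : 0 < l) (hl : k < l) :
    IsNear l P x := by
  have := cthickening_subset_thickening' h0 hl P h
  rw [mem_thickening_iff] at this
  obtain ⟨p, hp, hxp⟩ := this
  exact ⟨p, hp, hxp.le⟩

end IsNear

/-! ### Pointwise form of the hypotheses -/

/-- The hypotheses of the guessing geodesics lemma, with all constants replaced by one `E ≥ 1` and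
all neighbourhoods by explicit points. -/
structure GuessedGeodesics {X : Type*} [MetricSpace X] (Ps : Set (Set X)) (η : X → X → ℝ → X)
    (tr : X → X → Set X) (E : ℝ) : Prop where
  geodesic : IsGeodesicSpace X
  one_le : 1 ≤ E
  continuous : ∀ x y, Continuous (η x y)
  source : ∀ x y, η x y 0 = x
  target : ∀ x y, η x y 1 = y
  isClosed : ∀ x y, IsClosed (tr x y)
  exists_param : ∀ x y, ∀ z ∈ tr x y, ∃ r ∈ Icc (0 : ℝ) 1, η x y r = z
  dist_le_of_near : ∀ x y, dist x y ≤ 2 → ∀ z ∈ tr x y, ∀ w ∈ tr x y, dist z w ≤ E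
  subpath : ∀ x y, ∀ s ∈ Icc (0 : ℝ) 1, ∀ t ∈ Icc (0 : ℝ) 1, ∀ z ∈ tr (η x y s) (η x y t),
    (∃ r ∈ uIcc s t, η x y r ∈ tr x y ∧ dist z (η x y r) ≤ E) ∨
      dist z (η x y s) ≤ E ∨ dist z (η x y t) ≤ E
  suppath : ∀ x y, ∀ s ∈ Icc (0 : ℝ) 1, ∀ t ∈ Icc (0 : ℝ) 1, ∀ r ∈ uIcc s t, η x y r ∈ tr x y →
    ∃ w ∈ tr (η x y s) (η x y t), dist (η x y r) w ≤ E
  left_near : ∀ x y, ∃ w ∈ tr x y, dist x w ≤ E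
  right_near : ∀ x y, ∃ w ∈ tr x y, dist y w ≤ E
  thin : ∀ x y z, ∀ w ∈ tr x y, ∃ w', (w' ∈ tr x z ∨ w' ∈ tr z y) ∧ dist w w' ≤ E
  exists_of_not_common : ∀ x y, ∀ s ∈ Icc (0 : ℝ) 1, ∀ t ∈ Icc (0 : ℝ) 1,
    (¬ ∃ P ∈ Ps, η x y s ∈ P ∧ η x y t ∈ P) → ∃ r ∈ uIcc s t, η x y r ∈ tr x y
  alphaOne : ∀ K : ℝ, ∃ B : ℝ, ∀ P ∈ Ps, ∀ Q ∈ Ps, P ≠ Q → ∀ z w,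
    IsNear K P z → IsNear K Q z → IsNear K P w → IsNear K Q w → dist z w ≤ B
  peripheral : ∀ k : ℝ, ∃ K : ℝ, ∀ P ∈ Ps, ∀ x y, IsNear k P x → IsNear k P y → K ≤ dist x y →
    ∀ z ∈ tr x y, dist z x ≤ K ∨ dist z y ≤ K

theorem GuessedGeodesics.of_path {X : Type*} [MetricSpace X] (hX : IsGeodesicSpace X)
    (Ps : Set (Set X))
    (η : ∀ x y : X, Path x y) (tr : X → X → Set X)
    (tr_closed : ∀ x y, IsClosed (tr x y)) (tr_subset : ∀ x y, tr x y ⊆ range (η x y))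
    (D : ℝ)
    (h1 : ∀ x y, dist x y ≤ 2 → ediam (tr x y) ≤ ENNReal.ofReal D)
    (h2 : ∀ x y, ∀ s t : unitInterval,
      hausdorffEDist (tr (η x y s) (η x y t))
        ((tr x y ∩ η x y '' uIcc s t) ∪ {η x y s, η x y t}) ≤ ENNReal.ofReal D)
    (h3 : ∀ x y z, tr x y ⊆ cthickening D (tr x z ∪ tr z y))
    (h4 : ∀ x y, ∀ s t : unitInterval, (¬ ∃ P ∈ Ps, η x y s ∈ P ∧ η x y t ∈ P) →
      ∃ z ∈ tr x y, z ∈ η x y '' uIcc s t)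
    (h5 : AlphaOne Ps)
    (h6 : ∀ k : ℝ, ∃ K : ℝ, ∀ P ∈ Ps, ∀ x y,
      x ∈ cthickening k P → y ∈ cthickening k P → K ≤ dist x y →
      tr x y ⊆ closedBall x K ∪ closedBall y K ∧ ∃ z ∈ tr x y, z ∈ cthickening D P) :
    GuessedGeodesics Ps (fun x y => (η x y).extend) tr (max D 0 + 1) := by
  -- The strict inequality `D < E` turns bounds on infima, which need not be attained, into actual
  -- points.
  set E : ℝ := max D 0 + 1 with hE
  have hDE : D < E := by have := le_max_left D 0; linarith
  have h0E : 0 < E := by have := le_max_right D 0; linarith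
  have hlt : ENNReal.ofReal D < ENNReal.ofReal E :=
    (ENNReal.ofReal_lt_ofReal_iff h0E).2 hDE
  have ext : ∀ x y s (hs : s ∈ Icc (0 : ℝ) 1), (η x y).extend s = η x y ⟨s, hs⟩ :=
    fun x y s hs => Path.extend_apply _ hs
  have conv : ∀ {z w : X}, edist z w < ENNReal.ofReal E → dist z w ≤ E := fun {z w} h => by
    rw [edist_dist] at h
    exact ((ENNReal.ofReal_lt_ofReal_iff h0E).1 h).le
  have mem : ∀ {s t : unitInterval} {r : ℝ}, r ∈ uIcc (s : ℝ) t →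
      ∃ hr : r ∈ Icc (0 : ℝ) 1, (⟨r, hr⟩ : unitInterval) ∈ uIcc s t := fun {s t r} hr => by
    have hr' : r ∈ Icc (0 : ℝ) 1 := by
      have := uIcc_subset_Icc s.2 t.2
      exact this hr
    refine ⟨hr', ?_⟩
    rcases le_total s t with h | h
    · rw [uIcc_of_le h]; rw [uIcc_of_le (show (s : ℝ) ≤ t from h)] at hr
      exact ⟨hr.1, hr.2⟩
    · rw [uIcc_of_ge h]; rw [uIcc_of_ge (show (t : ℝ) ≤ s from h)] at hr
      exact ⟨hr.1, hr.2⟩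
  have mem' : ∀ {s t r : unitInterval}, r ∈ uIcc s t → (r : ℝ) ∈ uIcc (s : ℝ) t :=
    fun {s t r} hr => by
    rcases le_total s t with h | h
    · rw [uIcc_of_le (show (s : ℝ) ≤ t from h)]; rw [uIcc_of_le h] at hr
      exact ⟨hr.1, hr.2⟩
    · rw [uIcc_of_ge (show (t : ℝ) ≤ s from h)]; rw [uIcc_of_ge h] at hr
      exact ⟨hr.1, hr.2⟩
  have sup : ∀ x y, ∀ s t : unitInterval,
      ∀ p ∈ (tr x y ∩ η x y '' uIcc s t) ∪ {η x y s, η x y t},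
      ∃ w ∈ tr (η x y s) (η x y t), dist p w ≤ E := fun x y s t p hp => by
    have hH := (h2 x y s t).trans_lt hlt
    rw [hausdorffEDist_comm] at hH
    obtain ⟨w, hw, hd⟩ := exists_edist_lt_of_hausdorffEDist_lt hp hH
    exact ⟨w, hw, conv hd⟩
  refine ⟨hX, ?_, fun x y => (η x y).continuous_extend, fun x y => by simp, fun x y => by simp,
    tr_closed, ?_, ?_, ?_, ?_, ?_, ?_, ?_, ?_, ?_, ?_⟩
  · have := le_max_right D 0; linarith
  · intro x y z hz
    obtain ⟨r, rfl⟩ := tr_subset x y hz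
    exact ⟨r, r.2, ext x y r r.2⟩
  · intro x y hxy z hz w hw
    have := (edist_le_ediam_of_mem hz hw).trans (h1 x y hxy)
    exact conv (this.trans_lt hlt)
  · intro x y s hs t ht z hz
    simp only [ext x y s hs, ext x y t ht] at hz ⊢
    obtain ⟨w, hw, hd⟩ :=
      exists_edist_lt_of_hausdorffEDist_lt hz ((h2 x y ⟨s, hs⟩ ⟨t, ht⟩).trans_lt hlt)
    rcases hw with ⟨hw, r, hr, rfl⟩ | rfl | rfl
    · exact Or.inl ⟨r, mem' hr, by rw [ext x y r r.2]; exact ⟨hw, conv hd⟩⟩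
    · exact Or.inr (Or.inl (conv hd))
    · exact Or.inr (Or.inr (conv hd))
  · intro x y s hs t ht r hr hrt
    obtain ⟨hr', hr''⟩ := mem (s := ⟨s, hs⟩) (t := ⟨t, ht⟩) hr
    simp only [ext x y s hs, ext x y t ht, ext x y r hr'] at hrt ⊢
    exact sup x y _ _ _ (Or.inl ⟨hrt, _, hr'', rfl⟩)
  · intro x y
    -- On the whole path both transient sets are `tr x y`, so the endpoints added in condition 2 are
    -- themselves near `tr x y`.
    have := sup x y 0 1 x (Or.inr (by simp))
    simpa using this
  · intro x y
    have := sup x y 0 1 y (Or.inr (by simp))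
    simpa using this
  · intro x y z w hw
    obtain ⟨w', hw', hd⟩ := isNear_of_mem_cthickening (h3 x y z hw) h0E hDE
    exact ⟨w', hw', hd⟩
  · intro x y s hs t ht h
    simp only [ext x y s hs, ext x y t ht] at h
    obtain ⟨z, hz, r, hr, rfl⟩ := h4 x y _ _ h
    exact ⟨r, mem' hr, by rw [ext x y r r.2]; exact hz⟩
  · intro K
    obtain ⟨B, hB⟩ := h5 K
    refine ⟨max B 0, fun P hP Q hQ hPQ z w h1 h2 h3 h4 => ?_⟩
    have := (edist_le_ediam_of_mem (s := cthickening K P ∩ cthickening K Q)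
      ⟨h1.mem_cthickening le_rfl, h2.mem_cthickening le_rfl⟩
      ⟨h3.mem_cthickening le_rfl, h4.mem_cthickening le_rfl⟩).trans (hB P hP Q hQ hPQ)
    rw [edist_dist, ENNReal.ofReal_le_ofReal_iff'] at this
    rcases this with h | h
    · exact h.trans (le_max_left _ _)
    · exact h.trans (le_max_right _ _)
  · intro k
    obtain ⟨K, hK⟩ := h6 k
    refine ⟨K, fun P hP x y hx hy hd z hz => ?_⟩
    have := (hK P hP x y (hx.mem_cthickening le_rfl) (hy.mem_cthickening le_rfl) hd).1 hz
    simpa using this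

/-! ### Almost-geodesics, and gaps along paths -/

theorem IsAlmostGeodesic.reverse {X : Type*} [MetricSpace X] {l C : ℝ} {γ : ℝ → X} {a b : ℝ}
    {x y : X} (h : IsAlmostGeodesic l C γ a b x y) :
    IsAlmostGeodesic l C (fun t => γ (-t)) (-b) (-a) y x := by
  have hm : ∀ s ∈ Icc (-b) (-a), -s ∈ Icc a b := fun s hs =>
    ⟨by linarith [hs.2], by linarith [hs.1]⟩
  have e : ∀ s t : ℝ, |s - t| = |-s - -t| := fun s t => by rw [← abs_neg]; ring_nf
  refine ⟨by linarith [h.le], by simp [h.target], by simp [h.source],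
    h.continuousOn.comp continuous_neg.continuousOn hm, fun s hs t ht => ?_, fun s hs t ht => ?_⟩
  · rw [e]; exact h.lower _ (hm s hs) _ (hm t ht)
  · rw [e]; exact h.upper _ (hm s hs) _ (hm t ht)

theorem IsAlmostGeodesic.restrict {X : Type*} [MetricSpace X] {l C : ℝ} {γ : ℝ → X} {a b s t : ℝ}
    {x y : X} (h : IsAlmostGeodesic l C γ a b x y) (has : a ≤ s) (hst : s ≤ t) (htb : t ≤ b) :
    IsAlmostGeodesic l C γ s t (γ s) (γ t) := by
  have hsub : Icc s t ⊆ Icc a b := Icc_subset_Icc has htb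
  exact ⟨hst, rfl, rfl, h.continuousOn.mono hsub, fun u hu v hv => h.lower u (hsub hu) v (hsub hv),
    fun u hu v hv => h.upper u (hsub hu) v (hsub hv)⟩

theorem IsGeodesic.isAlmostGeodesic {X : Type*} [MetricSpace X] {γ : ℝ → X} {x y : X}
    (h : IsGeodesic γ x y) : IsAlmostGeodesic 1 0 γ 0 (dist x y) x y := by
  refine ⟨dist_nonneg, h.source, h.target, ?_, fun s hs t ht => ?_, fun s hs t ht => ?_⟩
  · refine (LipschitzOnWith.of_dist_le_mul (K := 1) fun s hs t ht => ?_).continuousOn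
    rw [h.isometric s hs t ht, Real.dist_eq]; simp
  · rw [h.isometric s hs t ht]; simp
  · rw [h.isometric s hs t ht]; simp

/-- A path on which any two points lie on a common peripheral set, unless a point of `A ∪ B`
occurs between them, and which goes from `A` to `B`: either it meets `A ∩ B`, or some peripheral
set passes near points of `A` and of `B`. -/
theorem exists_gap {X : Type*} [MetricSpace X] {Ps : Set (Set X)} {f : ℝ → X} (hf : Continuous f)
    {A B : Set X} (hA : IsClosed A) (hB : IsClosed B) {a b : ℝ} (hab : a ≤ b)
    (ha : f a ∈ A) (hb : f b ∈ B)
    (h : ∀ s ∈ Icc a b, ∀ t ∈ Icc a b, s ≤ t → (¬ ∃ P ∈ Ps, f s ∈ P ∧ f t ∈ P) →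
      ∃ r ∈ Icc s t, f r ∈ A ∪ B) :
    (∃ r ∈ Icc a b, f r ∈ A ∩ B) ∨ ∃ P ∈ Ps, ∃ s ∈ Icc a b, ∃ t ∈ Icc a b,
      f s ∈ A ∧ f t ∈ B ∧ IsNear 1 P (f s) ∧ IsNear 1 P (f t) := by
  -- With `s` the last time in `A` and `t` the first later time in `B`, no point strictly between
  -- them lies in `A ∪ B`; interior points close to both ends therefore share a peripheral set.
  obtain ⟨s, ⟨hs, hsA⟩, hsmax⟩ : ∃ s, IsGreatest (Icc a b ∩ f ⁻¹' A) s :=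
    (isCompact_Icc.inter_right (hA.preimage hf)).exists_isGreatest ⟨a, ⟨le_rfl, hab⟩, ha⟩
  obtain ⟨t, ⟨ht, htB⟩, htmin⟩ : ∃ t, IsLeast (Icc s b ∩ f ⁻¹' B) t :=
    (isCompact_Icc.inter_right (hB.preimage hf)).exists_isLeast ⟨b, ⟨hs.2, le_rfl⟩, hb⟩
  have htab : t ∈ Icc a b := ⟨hs.1.trans ht.1, ht.2⟩
  rcases ht.1.eq_or_lt with rfl | hst
  · exact Or.inl ⟨s, hs, hsA, htB⟩
  right
  have hnear : ∀ u, ∃ δ > 0, ∀ r, |r - u| < δ → dist (f r) (f u) < 1 := fun u => by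
    obtain ⟨δ, hδ, h⟩ := Metric.continuous_iff.1 hf u 1 one_pos
    exact ⟨δ, hδ, fun r hr => h r (by rwa [Real.dist_eq])⟩
  obtain ⟨δ₁, hδ₁, h₁⟩ := hnear s
  obtain ⟨δ₂, hδ₂, h₂⟩ := hnear t
  set ε := min (min (δ₁ / 2) (δ₂ / 2)) ((t - s) / 2) with hε
  have hε0 : 0 < ε := lt_min (lt_min (by linarith) (by linarith)) (by linarith)
  have e1 : ε ≤ δ₁ / 2 := (min_le_left _ _).trans (min_le_left _ _)
  have e2 : ε ≤ δ₂ / 2 := (min_le_left _ _).trans (min_le_right _ _)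
  have e3 : ε ≤ (t - s) / 2 := min_le_right _ _
  have hcommon : ∃ P ∈ Ps, f (s + ε) ∈ P ∧ f (t - ε) ∈ P := by
    by_contra hno
    obtain ⟨r, hr, hrA | hrB⟩ := h (s + ε) ⟨by linarith [hs.1], by linarith [ht.2]⟩ (t - ε)
      ⟨by linarith [hs.1], by linarith [ht.2]⟩ (by linarith) hno
    · have := hsmax ⟨⟨by linarith [hs.1, hr.1], by linarith [ht.2, hr.2]⟩, hrA⟩
      linarith [hr.1]
    · have := htmin ⟨⟨by linarith [hs.1, hr.1], by linarith [ht.2, hr.2]⟩, hrB⟩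
      linarith [hr.2]
  obtain ⟨P, hP, hsP, htP⟩ := hcommon
  refine ⟨P, hP, s, hs, t, htab, hsA, htB, ⟨_, hsP, ?_⟩, ⟨_, htP, ?_⟩⟩
  · rw [dist_comm]
    exact (h₁ _ (by rw [add_sub_cancel_left, abs_of_pos hε0]; linarith)).le
  · rw [dist_comm]
    refine (h₂ _ ?_).le
    rw [show t - ε - t = -ε by ring, abs_neg, abs_of_pos hε0]; linarith

/-- Along a path, a property which fails at the start and holds at the end fails and holds at
nearby points. -/
theorem exists_change {X : Type*} [MetricSpace X] {f : ℝ → X} (hf : Continuous f) {a b : ℝ}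
    (hab : a ≤ b) {p : ℝ → Prop} (ha : ¬ p a) (hb : p b) :
    ∃ s ∈ Icc a b, ∃ t ∈ Icc a b, ¬ p s ∧ p t ∧ dist (f s) (f t) ≤ 1 := by
  by_contra! hno
  set S : Set ℝ := {t | t ∈ Icc a b ∧ p t}
  have hSb : b ∈ S := ⟨⟨hab, le_rfl⟩, hb⟩
  have hbdd : BddBelow S := ⟨a, fun t ht => ht.1.1⟩
  set u := sInf S
  have hau : a ≤ u := le_csInf ⟨b, hSb⟩ fun t ht => ht.1.1
  have hub : u ≤ b := csInf_le hbdd hSb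
  obtain ⟨δ, hδ, h⟩ := Metric.continuous_iff.1 hf u (1 / 2) (by norm_num)
  obtain ⟨t, ht, htu⟩ := exists_lt_of_csInf_lt ⟨b, hSb⟩ (show sInf S < u + δ by linarith)
  have hut : u ≤ t := csInf_le hbdd ht
  have htd := h t (by rw [Real.dist_eq, abs_of_nonneg (by linarith)]; linarith)
  -- Near the infimum `u` all values are within 1 of `f t`, so `p` spreads to a full neighbourhood
  -- of `u`, also to the left of it.
  have key : ∀ s ∈ Icc a b, dist s u < δ → p s := fun s hs hd => by
    by_contra hps
    have h1 := hno s hs t ht.1 hps ht.2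
    have h2 := h s hd
    linarith [dist_triangle_right (f s) (f t) (f u)]
  have hpu : p u := key u ⟨hau, hub⟩ (by simpa using hδ)
  have hau' : a < u := lt_of_le_of_ne hau fun h => ha (h ▸ hpu)
  have hm : max a (u - δ / 2) ∈ Icc a b := ⟨le_max_left _ _, max_le hab (by linarith)⟩
  have hlt : max a (u - δ / 2) < u := max_lt hau' (by linarith)
  have := key _ hm (by
    rw [Real.dist_eq, abs_of_neg (by linarith)]
    linarith [le_max_right a (u - δ / 2)])
  exact absurd (csInf_le hbdd ⟨hm, this⟩) (not_le.2 hlt)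

/-! ### Thin polygons and logarithmic estimates -/

namespace GuessedGeodesics

variable {X : Type*} [MetricSpace X] {Ps : Set (Set X)} {η : X → X → ℝ → X} {tr : X → X → Set X}
  {E : ℝ}

/-- The whole path read backwards is a subpath of itself, since parameters may occur in either
order. -/
theorem symm (h : GuessedGeodesics Ps η tr E) {x y z : X} (hz : z ∈ tr x y) :
    ∃ w ∈ tr y x, dist z w ≤ E := by
  obtain ⟨r, hr, rfl⟩ := h.exists_param x y z hz
  have := h.suppath x y 1 (by simp) 0 (by simp) r (by rw [uIcc_of_ge zero_le_one]; exact hr) hz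
  rwa [h.source, h.target] at this

/-- The substitute for connectedness of `tr x y` in all later covering arguments. -/
theorem exists_gap_tr (h : GuessedGeodesics Ps η tr E) {x y : X} {A B : Set X} (hA : IsClosed A)
    (hB : IsClosed B) (hx : x ∈ A) (hy : y ∈ B) (hAB : tr x y ⊆ A ∪ B) :
    (∃ z, z ∈ A ∧ z ∈ B) ∨ ∃ P ∈ Ps, ∃ z ∈ A, ∃ w ∈ B, IsNear 1 P z ∧ IsNear 1 P w := by
  have := exists_gap (Ps := Ps) (h.continuous x y) hA hB zero_le_one (by rwa [h.source])
    (by rwa [h.target]) (fun s hs t ht hst hno => by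
      obtain ⟨r, hr, hrt⟩ := h.exists_of_not_common x y s hs t ht hno
      exact ⟨r, by rwa [uIcc_of_le hst] at hr, hAB hrt⟩)
  rcases this with ⟨r, -, hr⟩ | ⟨P, hP, s, -, t, -, hs, ht, hPs, hPt⟩
  · exact Or.inl ⟨_, hr.1, hr.2⟩
  · exact Or.inr ⟨P, hP, _, hs, _, ht, hPs, hPt⟩

/-- Thinness of polygons, with a logarithmic constant. -/
theorem chain (h : GuessedGeodesics Ps η tr E) (f : ℕ → X) (k : ℕ) :
    ∀ i n : ℕ, 1 ≤ n → n ≤ 2 ^ k → ∀ z ∈ tr (f i) (f (i + n)),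
      ∃ j, i ≤ j ∧ j < i + n ∧ ∃ w ∈ tr (f j) (f (j + 1)), dist z w ≤ k * E := by
  have hE := h.one_le
  induction k with
  | zero =>
    intro i n h1 h2 z hz
    obtain rfl : n = 1 := by simp at h2; omega
    exact ⟨i, le_rfl, by omega, z, hz, by simp⟩
  | succ k ih =>
    intro i n h1 h2 z hz
    rcases le_or_gt n (2 ^ k) with hn | hn
    · obtain ⟨j, hj1, hj2, w, hw, hd⟩ := ih i n h1 hn z hz
      exact ⟨j, hj1, hj2, w, hw, by push_cast; linarith⟩
    have hpow : 1 ≤ 2 ^ k := Nat.one_le_two_pow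
    -- Cutting off `2 ^ k` sides leaves at most `2 ^ k` others, so doubling the number of sides
    -- costs a single `E`.
    obtain ⟨w, hw | hw, hd⟩ := h.thin _ _ (f (i + 2 ^ k)) z hz
    · obtain ⟨j, hj1, hj2, w', hw', hd'⟩ := ih i (2 ^ k) hpow le_rfl w hw
      exact ⟨j, hj1, by omega, w', hw', by push_cast; linarith [dist_triangle z w w']⟩
    · rw [show i + n = i + 2 ^ k + (n - 2 ^ k) by omega] at hw
      obtain ⟨j, hj1, hj2, w', hw', hd'⟩ :=
        ih (i + 2 ^ k) (n - 2 ^ k) (by omega) (by rw [pow_succ] at h2; omega) w hw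
      exact ⟨j, by omega, by omega, w', hw', by push_cast; linarith [dist_triangle z w w']⟩

/-- Unit steps along `β` form a polygon with `2 ^ k` sides, each with a transient set of size at
most `F`. Vertices beyond the end are all equal to `y`. -/
theorem dist_almostGeodesic_le_of_bound (h : GuessedGeodesics Ps η tr E) {C F : ℝ}
    (hF : ∀ x y, dist x y ≤ 1 + C → ∀ z ∈ tr x y, dist z x ≤ F) {β : ℝ → X} {a b : ℝ} {x y : X}
    (hβ : IsAlmostGeodesic 1 C β a b x y) {k : ℕ} (hk : b - a ≤ 2 ^ k) {z : X} (hz : z ∈ tr x y) :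
    ∃ r ∈ Icc a b, dist z (β r) ≤ k * E + F := by
  set f : ℕ → X := fun i => β (min (a + i) b) with hf
  have h0 : f 0 = x := by simp [hf, min_eq_left hβ.le, hβ.source]
  have hn : f (0 + 2 ^ k) = y := by
    have : min (a + (2 : ℝ) ^ k) b = b := min_eq_right (by linarith)
    simp [hf, this, hβ.target]
  have hmem : ∀ i : ℕ, min (a + i) b ∈ Icc a b := fun i =>
    ⟨le_min (by simp) hβ.le, min_le_right _ _⟩
  obtain ⟨j, -, -, w, hw, hd⟩ := h.chain f k 0 (2 ^ k) Nat.one_le_two_pow le_rfl z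
    (by rwa [h0, hn])
  refine ⟨_, hmem j, ?_⟩
  have hstep : dist (f j) (f (j + 1)) ≤ 1 + C := by
    refine (hβ.upper _ (hmem j) _ (hmem (j + 1))).trans ?_
    have : |min (a + (j : ℝ)) b - min (a + ((j + 1 : ℕ) : ℝ)) b| ≤ 1 := by
      refine (abs_min_sub_min_le_max _ _ _ _).trans ?_
      push_cast
      rw [show a + (j : ℝ) - (a + (j + 1)) = -1 by ring]
      simp
    linarith
  linarith [dist_triangle z w (f j), hF _ _ hstep w hw]

theorem dist_le_two_mul (h : GuessedGeodesics Ps η tr E) {x y z : X} (hxy : dist x y ≤ 2)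
    (hz : z ∈ tr x y) : dist z x ≤ 2 * E := by
  obtain ⟨w, hw, hd⟩ := h.left_near x y
  linarith [h.dist_le_of_near x y hxy z hz w hw, dist_triangle z w x, dist_comm x w]

/-- `tr x y` is contained in a neighbourhood of any geodesic, with a logarithmic constant. -/
theorem exists_between (h : GuessedGeodesics Ps η tr E) {x y z : X} {k : ℕ}
    (hk : dist x y ≤ 2 ^ k) (hz : z ∈ tr x y) :
    ∃ q, dist x q ≤ dist x y ∧ dist z q ≤ (k + 2) * E := by
  obtain ⟨γ, hγ⟩ := h.geodesic x y
  obtain ⟨r, hr, hd⟩ := h.dist_almostGeodesic_le_of_bound (F := 2 * E)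
    (fun x y hxy z hz => h.dist_le_two_mul (by linarith) hz) hγ.isAlmostGeodesic (by simpa using hk) hz
  refine ⟨γ r, ?_, by linarith⟩
  · have := hγ.isometric 0 ⟨le_rfl, dist_nonneg⟩ r hr
    rw [hγ.source, zero_sub, abs_neg, abs_of_nonneg hr.1] at this
    linarith [hr.2]

theorem exists_bound (h : GuessedGeodesics Ps η tr E) (R : ℝ) :
    ∃ F, 0 ≤ F ∧ ∀ x y, dist x y ≤ R → ∀ z ∈ tr x y, dist z x ≤ F := by
  have hE := h.one_le
  have hk : R ≤ 2 ^ ⌈R⌉₊ := (Nat.le_ceil R).trans (by exact_mod_cast Nat.lt_two_pow_self.le)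
  refine ⟨max R 0 + (⌈R⌉₊ + 2) * E, by positivity, fun x y hxy z hz => ?_⟩
  obtain ⟨q, hq, hd⟩ := h.exists_between (hxy.trans hk) hz
  linarith [le_max_left R 0, dist_triangle z q x, dist_comm x q]

theorem exists_perturb (h : GuessedGeodesics Ps η tr E) (R : ℝ) :
    ∃ F, 0 ≤ F ∧ ∀ x x' y, dist x x' ≤ R → ∀ z ∈ tr x y, ∃ w ∈ tr x' y, dist z w ≤ F := by
  have hE := h.one_le
  obtain ⟨F, hF0, hF⟩ := h.exists_bound R
  refine ⟨F + max R 0 + 2 * E, by positivity, fun x x' y hd z hz => ?_⟩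
  have hR := le_max_left R 0
  have hR0 := le_max_right R 0
  obtain ⟨w, hw | hw, hzw⟩ := h.thin x y x' z hz
  · obtain ⟨u, hu, hxu⟩ := h.left_near x' y
    refine ⟨u, hu, ?_⟩
    linarith [hF x x' hd w hw, dist_triangle z w u, dist_triangle w x u, dist_triangle x x' u]
  · exact ⟨w, hw, by linarith⟩

/-- Removes the lower bound on `dist x y` from condition 6: for close endpoints the whole transient
set is bounded. -/
theorem exists_peripheral_bound (h : GuessedGeodesics Ps η tr E) (k : ℝ) :
    ∃ K, 0 ≤ K ∧ ∀ P ∈ Ps, ∀ x y, IsNear k P x → IsNear k P y → ∀ z ∈ tr x y,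
      dist z x ≤ K ∨ dist z y ≤ K := by
  obtain ⟨K, hK⟩ := h.peripheral k
  obtain ⟨F, hF0, hF⟩ := h.exists_bound K
  refine ⟨max K F, hF0.trans (le_max_right _ _), fun P hP x y hx hy z hz => ?_⟩
  rcases le_total K (dist x y) with hd | hd
  · exact (hK P hP x y hx hy hd z hz).imp (fun h => h.trans (le_max_left _ _))
      (fun h => h.trans (le_max_left _ _))
  · exact Or.inl ((hF x y hd z hz).trans (le_max_right _ _))

end GuessedGeodesics

/-! ### Gates and coarse projections -/

/-- `u` is a point near `P` such that the transient sets from `x` to all points near `P` pass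
near `u`. -/
def IsGate {X : Type*} [MetricSpace X] (tr : X → X → Set X) (κ : ℝ) (c : ℝ → ℝ) (P : Set X)
    (x u : X) : Prop :=
  IsNear κ P u ∧ ∀ k v, IsNear k P v → ∃ w ∈ tr x v, dist u w ≤ c k

namespace GuessedGeodesics

variable {X : Type*} [MetricSpace X] {Ps : Set (Set X)} {η : X → X → ℝ → X} {tr : X → X → Set X}
  {E : ℝ}

/-- If `tr x v` missed the entrance point `u`, let `a` move from `x` to `u` along the path and stop
just before `tr a v` comes close to `u`. Then `tr a v` passes `u` at a bounded but not small
distance and continues to `v`. The triangle on `u`, `v` forces a jump there along a peripheral set,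
which must be `P`; hence the path meets a neighbourhood of `P` before `u`. -/
theorem exists_dist_entrance_le (h : GuessedGeodesics Ps η tr E) (k : ℝ) :
    ∃ c, ∀ P ∈ Ps, ∀ x q v, ∀ t ∈ Icc (0 : ℝ) 1,
      (∀ s ∈ Icc (0 : ℝ) 1, s < t → ¬ IsNear (4 * E + 1) P (η x q s)) →
      IsNear (4 * E + 3) P (η x q t) → IsNear k P v → ∃ w ∈ tr x v, dist (η x q t) w ≤ c := by
  have hE := h.one_le
  set k' := max k (4 * E + 3)
  have hk : k ≤ k' := le_max_left _ _
  have hk4 : 4 * E + 3 ≤ k' := le_max_right _ _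
  obtain ⟨K, hK0, hK⟩ := h.exists_peripheral_bound k'
  obtain ⟨D', hD0, hD⟩ := h.exists_perturb 1
  set c₁ := K + 10 * E with hc₁
  obtain ⟨F, hF0, hF⟩ := h.exists_bound (c₁ + D')
  set R := E + F + c₁ + D' with hR
  obtain ⟨B, hB⟩ := h.alphaOne (k' + R + K + E)
  set T := R + max B 0 + 2 * K + 4 * E with hT
  have hB0 := le_max_right B 0
  have hB1 := le_max_left B 0
  refine ⟨T + E + c₁, fun P hP x q v t ht hfirst hu hv => ?_⟩
  set u := η x q t with hu_def
  have hu' : IsNear k' P u := hu.mono hk4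
  have hv' : IsNear k' P v := hv.mono hk
  by_contra! hno
  have huv : T < dist u v := by
    obtain ⟨w, hw, hd⟩ := h.right_near x v
    linarith [hno w hw, dist_triangle u v w]
  obtain ⟨s, hs, s', -, hps, ⟨w₀, hw₀, hd₀⟩, hss⟩ := exists_change (h.continuous x q) ht.1
    (p := fun s => ∃ w ∈ tr (η x q s) v, dist u w ≤ c₁)
    (by
      rintro ⟨w, hw, hd⟩
      rw [h.source] at hw
      linarith [hno w hw])
    (by
      obtain ⟨w, hw, hd⟩ := h.left_near u v
      exact ⟨w, hw, by linarith⟩)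
  push Not at hps
  set a := η x q s with ha
  obtain ⟨w, hw, hww⟩ := hD _ a v (by rwa [dist_comm]) w₀ hw₀
  have hwu : dist w u ≤ c₁ + D' := by
    linarith [dist_triangle w w₀ u, dist_comm w w₀, dist_comm u w₀]
  obtain ⟨ρ, hρ, hρw⟩ := h.exists_param a v w hw
  have hclose : ∀ z ∈ tr w v ∪ {w}, ∃ z' ∈ tr a v, dist z z' ≤ 2 * E := by
    rintro z (hz | rfl)
    · have := h.subpath a v ρ hρ 1 (by simp) z (by rwa [hρw, h.target])
      rw [hρw, h.target] at this
      rcases this with ⟨r, -, hr, hd⟩ | hd | hd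
      · exact ⟨_, hr, by linarith⟩
      · exact ⟨w, hw, by linarith⟩
      · obtain ⟨z', hz', hd'⟩ := h.right_near a v
        exact ⟨z', hz', by linarith [dist_triangle z v z']⟩
    · exact ⟨z, hw, by rw [dist_self]; linarith⟩
  have hfar : ∀ z ∈ tr w v ∪ {w}, c₁ - 2 * E ≤ dist z u := fun z hz => by
    obtain ⟨z', hz', hd⟩ := hclose z hz
    linarith [hps z' hz', dist_triangle u z z', dist_comm u z]
  -- The side from `w` to `u` is short, and the transient set of `u` and `v` is concentrated near
  -- its ends.
  have hcover : ∀ z ∈ tr w v, dist z u ≤ R ∨ dist z v ≤ K + E := fun z hz => by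
    obtain ⟨z', hz' | hz', hd⟩ := h.thin w v u z hz
    · left
      linarith [hF w u hwu z' hz', dist_triangle z z' w, dist_triangle z w u]
    · rcases hK P hP u v hu' hv' z' hz' with hd' | hd'
      · left; linarith [dist_triangle z z' u, hfar z (Or.inl hz)]
      · right; linarith [dist_triangle z z' v]
  obtain ⟨z, hzA, hzB⟩ | ⟨Q, hQ, e₁, he₁, e₂, he₂, hn₁, hn₂⟩ := h.exists_gap_tr (x := w) (y := v)
    (A := (tr w v ∪ {w}) ∩ closedBall u R) (B := closedBall v (K + E))
    (((h.isClosed w v).union isClosed_singleton).inter isClosed_closedBall) isClosed_closedBall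
    ⟨Or.inr rfl, by rw [mem_closedBall]; linarith⟩ (by rw [mem_closedBall, dist_self]; linarith)
    (fun z hz => (hcover z hz).imp (fun hd => ⟨Or.inl hz, hd⟩) id)
  · have h1 : dist z u ≤ R := hzA.2
    have h2 : dist z v ≤ K + E := hzB
    linarith [dist_triangle_left u v z]
  have h1 : dist e₁ u ≤ R := he₁.2
  have h2 : dist e₂ v ≤ K + E := he₂
  -- `T` was chosen so that `u` and `v` are too far apart for two distinct peripheral sets to come
  -- near both.
  have hPQ : P = Q := by
    by_contra hPQ
    have := hB P hP Q hQ hPQ e₁ e₂ (hu'.of_dist_le h1 (by linarith)) (hn₁.mono (by linarith))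
      (hv'.of_dist_le h2 (by linarith)) (hn₂.mono (by linarith))
    linarith [dist_triangle_left u v e₁, dist_triangle e₁ e₂ v]
  subst hPQ
  have hfar₁ := hfar e₁ he₁.1
  obtain ⟨z', hz', hd'⟩ := hclose e₁ he₁.1
  obtain ⟨z'', hz'' | hz'', hd''⟩ := h.thin a v u z' hz'
  · have hpath : ∃ r ∈ Icc s t, dist z'' (η x q r) ≤ E := by
      rcases h.subpath x q s ⟨hs.1, hs.2.trans ht.2⟩ t ht z'' hz'' with ⟨r, hr, -, hd⟩ | hd | hd
      · exact ⟨r, by rwa [uIcc_of_le hs.2] at hr, hd⟩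
      · exact ⟨s, ⟨le_rfl, hs.2⟩, hd⟩
      · exact ⟨t, ⟨hs.2, le_rfl⟩, hd⟩
    obtain ⟨r, hr, hd⟩ := hpath
    have h4 : dist e₁ (η x q r) ≤ 4 * E := by
      linarith [dist_triangle e₁ z' z'', dist_triangle e₁ z'' (η x q r)]
    -- A time before `t` contradicts the first entrance; `t` itself puts `e₁` too close to `u`.
    rcases hr.2.lt_or_eq with hlt | rfl
    · exact hfirst r ⟨hs.1.trans hr.1, hr.2.trans ht.2⟩ hlt
        (hn₁.of_dist_le (by rwa [dist_comm]) le_rfl)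
    · linarith
  · have h3 : dist e₁ z'' ≤ 3 * E := by linarith [dist_triangle e₁ z' z'']
    rcases hK P hP u v hu' hv' z'' hz'' with hd | hd
    · linarith [dist_triangle e₁ z'' u]
    · linarith [dist_triangle e₁ z'' v, dist_triangle_left u v e₁]

theorem exists_isGate (h : GuessedGeodesics Ps η tr E) :
    ∃ κ c, 0 ≤ κ ∧ ∀ P ∈ Ps, P.Nonempty → ∀ x, ∃ u, IsGate tr κ c P x u := by
  have hE := h.one_le
  choose c hc using h.exists_dist_entrance_le
  refine ⟨4 * E + 3, c, by linarith, fun P hP ⟨q, hq⟩ x => ?_⟩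
  obtain ⟨t, ⟨ht, htP⟩, hmin⟩ :
      ∃ t, IsLeast (Icc (0 : ℝ) 1 ∩ η x q ⁻¹' cthickening (4 * E + 2) P) t :=
    (isCompact_Icc.inter_right (isClosed_cthickening.preimage (h.continuous x q))).exists_isLeast
      ⟨1, by simp, by
        rw [mem_preimage, h.target]
        exact mem_cthickening_of_dist_le q q _ P hq (by rw [dist_self]; linarith)⟩
  have hn : IsNear (4 * E + 3) P (η x q t) :=
    isNear_of_mem_cthickening htP (by linarith) (by linarith)
  refine ⟨η x q t, hn, fun k v hv => hc k P hP x q v t ht (fun s hs hst hns => ?_) hn hv⟩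
  exact absurd (hmin ⟨hs, hns.mem_cthickening (by linarith)⟩) (not_le.2 hst)

/-- If `z` is near `P`, then `tr x z` passes near the gate `u`, so the path to `u` has come close to
`u` before `z`. From there on its transient points remain close to `u`. -/
theorem exists_gate_bound (h : GuessedGeodesics Ps η tr E) (κ : ℝ) (c : ℝ → ℝ) (k : ℝ) :
    ∃ r, ∀ P x u, IsGate tr κ c P x u → ∀ z ∈ tr x u, IsNear k P z → dist z u ≤ r := by
  have hE := h.one_le
  obtain ⟨F, hF0, hF⟩ := h.exists_bound (c k + E)
  refine ⟨E + F + |c k| + E, fun P x u hu z hz hk => ?_⟩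
  have habs := le_abs_self (c k)
  obtain ⟨w, hw, hd⟩ := hu.2 k z hk
  obtain ⟨r, hr, rfl⟩ := h.exists_param x u z hz
  have key : ∀ r' ∈ Icc (0 : ℝ) r, dist w (η x u r') ≤ E →
      dist (η x u r) u ≤ E + F + |c k| + E := fun r' hr' hd' => by
    obtain ⟨z', hz', hdz⟩ := h.suppath x u r' ⟨hr'.1, hr'.2.trans hr.2⟩ 1 (by simp) r
      (by rw [uIcc_of_le (hr'.2.trans hr.2)]; exact ⟨hr'.2, hr.2⟩) hz
    rw [h.target] at hz'
    have h1 : dist (η x u r') u ≤ c k + E := by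
      linarith [dist_triangle u w (η x u r'), dist_comm u (η x u r')]
    have h2 := hF _ _ h1 z' hz'
    linarith [dist_triangle (η x u r) z' (η x u r'), dist_triangle (η x u r) (η x u r') u]
  have := h.subpath x u 0 (by simp) r hr w (by rwa [h.source])
  rcases this with ⟨r', hr', -, hd'⟩ | hd' | hd'
  · rw [uIcc_of_le hr.1] at hr'
    exact key r' hr' hd'
  · exact key 0 ⟨le_rfl, hr.1⟩ hd'
  · exact key r ⟨hr.1, le_rfl⟩ hd'

/-- Gates of the endpoints of a transient set which stays away from `P` are close. -/
theorem exists_contraction (h : GuessedGeodesics Ps η tr E) (κ : ℝ) (c : ℝ → ℝ) :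
    ∃ c₁ c₂, 0 ≤ c₁ ∧ 0 ≤ c₂ ∧ ∀ P x y u v, IsGate tr κ c P x u → IsGate tr κ c P y v →
      (∀ z ∈ tr x y, ¬ IsNear c₁ P z) → dist u v ≤ c₂ := by
  have hE := h.one_le
  set c₁ := |κ| + |c κ| + E
  obtain ⟨r, hr⟩ := h.exists_gate_bound κ c c₁
  refine ⟨c₁, |c κ| + E + |r|, by positivity, by positivity, fun P x y u v hu hv hno => ?_⟩
  have ha := le_abs_self (c κ)
  have hb := le_abs_self κ
  have hc := le_abs_self r
  obtain ⟨w, hw, hd⟩ := hu.2 κ v hv.1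
  -- `w'` is near `P`, so it cannot lie on `tr x y`; on `tr y v` it is close to the gate `v`.
  obtain ⟨w', hw', hd'⟩ := h.thin x v y w hw
  have hn : IsNear c₁ P w' :=
    hu.1.of_dist_le (r := c κ + E) (by linarith [dist_triangle u w w', dist_comm w' u])
      (by linarith)
  rcases hw' with hw' | hw'
  · exact absurd hn (hno w' hw')
  · linarith [hr P y v hv w' hw' hn, dist_triangle u w v, dist_triangle w w' v]

end GuessedGeodesics

/-! ### Estimates at a large scale -/

/-- Polygons of size `A * R` need `k` of order `log R` halvings, and a multiple of `log R` is
eventually below `R`. -/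
theorem exists_two_pow_ge_and_mul_le (A M : ℝ) :
    ∃ R₀ : ℝ, 1 ≤ R₀ ∧ ∀ R, R₀ ≤ R → ∃ k : ℕ, A * R ≤ 2 ^ k ∧ M * (k + 1) ≤ R := by
  set A' := max A 1
  have hA1 : 1 ≤ A' := le_max_right _ _
  have hA : A ≤ A' := le_max_left _ _
  have hM : 0 < |M| + 1 := by positivity
  have hε : 0 < 1 / (4 * A' * (|M| + 1)) := by positivity
  obtain ⟨k₀, hk₀⟩ := Filter.eventually_atTop.1
    ((tendsto_pow_const_div_const_pow_of_one_lt 1 (one_lt_two (α := ℝ))).eventually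
      (gt_mem_nhds hε))
  refine ⟨2 ^ (k₀ + 1), one_le_pow₀ one_le_two, fun R hR => ?_⟩
  have hR1 : 1 ≤ R := (one_le_pow₀ one_le_two).trans hR
  have hRA : R ≤ A' * R := le_mul_of_one_le_left (by linarith) hA1
  obtain ⟨n, hn1, hn2⟩ := exists_nat_pow_near (hR1.trans hRA) (one_lt_two (α := ℝ))
  have hkn : k₀ + 1 < n + 1 :=
    (pow_lt_pow_iff_right₀ (one_lt_two (α := ℝ))).1 ((hR.trans hRA).trans_lt hn2)
  refine ⟨n + 1, (mul_le_mul_of_nonneg_right hA (by linarith)).trans hn2.le, ?_⟩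
  have h1 := hk₀ (n + 1) (by omega)
  rw [pow_one, div_lt_div_iff₀ (by positivity) (by positivity), one_mul] at h1
  push_cast at h1 ⊢
  have h2 : 2 * A' * ((n + 1 : ℝ) * (|M| + 1) * 2) ≤ 2 * A' * R := by
    rw [pow_succ] at h1
    linarith
  have h3 : (n + 1 : ℝ) * (|M| + 1) * 2 ≤ R := le_of_mul_le_mul_left h2 (by positivity)
  have h4 : M * (n + 1 + 1 : ℝ) ≤ 2 * ((n + 1) * |M|) := by
    have : (n + 1 + 1 : ℝ) ≤ 2 * (n + 1) := by have : (0 : ℝ) ≤ n := n.cast_nonneg; linarith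
    calc M * (n + 1 + 1 : ℝ) ≤ |M| * (n + 1 + 1 : ℝ) :=
          mul_le_mul_of_nonneg_right (le_abs_self M) (by positivity)
      _ ≤ |M| * (2 * (n + 1)) := mul_le_mul_of_nonneg_left this (abs_nonneg M)
      _ = _ := by ring
  have : (0 : ℝ) ≤ n := n.cast_nonneg
  linarith

/-- At scale `R`, logarithmic errors along the path `β` and along geodesics are bounded by
`lam ≤ R / 100`, and so are all constants. -/
structure IsScale {X : Type*} [MetricSpace X] (Ps : Set (Set X)) (tr : X → X → Set X)
    (β : ℝ → X) (a b R lam : ℝ) : Prop where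
  one_le : 1 ≤ lam
  mul_le : 100 * lam ≤ R
  lower : ∀ s ∈ Icc a b, ∀ t ∈ Icc a b, |s - t| - lam ≤ dist (β s) (β t)
  upper : ∀ s ∈ Icc a b, ∀ t ∈ Icc a b, dist (β s) (β t) ≤ |s - t| + lam
  path : ∀ s ∈ Icc a b, ∀ t ∈ Icc a b, |s - t| ≤ 1000 * R → ∀ z ∈ tr (β s) (β t),
    ∃ r ∈ uIcc s t, dist z (β r) ≤ lam
  between : ∀ x y, dist x y ≤ 1000 * R → ∀ z ∈ tr x y,
    ∃ q, dist x q ≤ dist x y ∧ dist z q ≤ lam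
  thin : ∀ x y z, ∀ w ∈ tr x y, ∃ w', (w' ∈ tr x z ∨ w' ∈ tr z y) ∧ dist w w' ≤ lam
  peripheral : ∀ P ∈ Ps, ∀ x y, IsNear 1 P x → IsNear 1 P y → ∀ z ∈ tr x y,
    dist z x ≤ lam ∨ dist z y ≤ lam
  gate : ∀ P ∈ Ps, P.Nonempty → ∃ g : X → X,
    (∀ x, ∀ q ∈ P, dist x q ≤ 1000 * R → dist x (g x) ≤ dist x q + lam) ∧
    ∀ x y, (∀ z ∈ tr x y, ¬ IsNear lam P z) → dist (g x) (g y) ≤ lam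

namespace IsScale

variable {X : Type*} [MetricSpace X] {Ps : Set (Set X)} {tr : X → X → Set X}
  {β : ℝ → X} {a b R lam : ℝ}

theorem reverse (h : IsScale Ps tr β a b R lam) :
    IsScale Ps tr (fun t => β (-t)) (-b) (-a) R lam := by
  have hm : ∀ s ∈ Icc (-b) (-a), -s ∈ Icc a b := fun s hs =>
    ⟨by linarith [hs.2], by linarith [hs.1]⟩
  have e : ∀ s t : ℝ, |s - t| = |-s - -t| := fun s t => by rw [← abs_neg]; ring_nf
  refine { h with lower := ?_, upper := ?_, path := ?_ }
  · intro s hs t ht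
    rw [e]; exact h.lower _ (hm s hs) _ (hm t ht)
  · intro s hs t ht
    rw [e]; exact h.upper _ (hm s hs) _ (hm t ht)
  · intro s hs t ht hd z hz
    rw [e] at hd
    obtain ⟨r, hr, hzr⟩ := h.path _ (hm s hs) _ (hm t ht) hd z hz
    refine ⟨-r, ?_, by simpa using hzr⟩
    rw [mem_uIcc] at hr ⊢
    rcases hr with hr | hr
    · right; constructor <;> linarith [hr.1, hr.2]
    · left; constructor <;> linarith [hr.1, hr.2]

/-- A path joining two points near a peripheral set keeps returning near it. -/
theorem exists_return (h : IsScale Ps tr β a b R lam) {P : Set X} (hP : P ∈ Ps) {s t : ℝ}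
    (hs : s ∈ Icc a b) (ht : t ∈ Icc a b) (hst : s + 20 * R ≤ t)
    (hns : IsNear (R + 1) P (β s)) (hnt : IsNear (R + 1) P (β t)) :
    ∃ r ∈ Icc a b, s + 20 * R ≤ r ∧ r ≤ s + 30 * R ∧ IsNear (3 * R) P (β r) := by
  have h1 := h.one_le
  have hR := h.mul_le
  rcases le_or_gt t (s + 30 * R) with hts | hts
  · exact ⟨t, ht, hst, hts, hnt.mono (by linarith)⟩
  by_contra! hno
  obtain ⟨g, hg, hgc⟩ := h.gate P hP ⟨_, hns.choose_spec.1⟩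
  set S := {r | r ∈ Icc s t ∧ IsNear (3 * R) P (β r)}
  have hsub : Icc s t ⊆ Icc a b := Icc_subset_Icc hs.1 ht.2
  have hsS : s ∈ S := ⟨⟨le_rfl, by linarith⟩, hns.mono (by linarith)⟩
  have htS : t ∈ S := ⟨⟨by linarith, le_rfl⟩, hnt.mono (by linarith)⟩
  -- The near times need not form a closed set, so `u` and `v` only approximate the ends of the
  -- excursion away from `P`, up to 1.
  obtain ⟨u, ⟨huS, hu20⟩, hu⟩ : ∃ u, (u ∈ S ∧ u ≤ s + 20 * R) ∧
      ∀ r ∈ S, r ≤ s + 20 * R → r < u + 1 := by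
    have hbdd : BddAbove {u | u ∈ S ∧ u ≤ s + 20 * R} := ⟨_, fun r hr => hr.2⟩
    obtain ⟨u, hu, hlt⟩ := exists_lt_of_lt_csSup
      (s := {u | u ∈ S ∧ u ≤ s + 20 * R}) ⟨s, hsS, by linarith⟩ (sub_one_lt _)
    exact ⟨u, hu, fun r hr hr' => by linarith [le_csSup hbdd ⟨hr, hr'⟩]⟩
  obtain ⟨v, ⟨hvS, hv20⟩, hv⟩ : ∃ v, (v ∈ S ∧ s + 20 * R ≤ v) ∧
      ∀ r ∈ S, s + 20 * R ≤ r → v - 1 < r := by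
    have hbdd : BddBelow {u | u ∈ S ∧ s + 20 * R ≤ u} := ⟨_, fun r hr => hr.2⟩
    obtain ⟨u, hu, hlt⟩ := exists_lt_of_csInf_lt
      (s := {u | u ∈ S ∧ s + 20 * R ≤ u}) ⟨t, htS, by linarith⟩ (lt_add_one _)
    exact ⟨u, hu, fun r hr hr' => by linarith [csInf_le hbdd ⟨hr, hr'⟩]⟩
  have hv30 : s + 30 * R < v := by
    by_contra! hle
    exact hno v (hsub hvS.1) hv20 hle hvS.2
  have hfar : ∀ r ∈ Icc (u + 1) (v - 1), ¬ IsNear (3 * R) P (β r) := fun r hr hn => by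
    have hrS : r ∈ S := ⟨⟨by linarith [huS.1.1, hr.1], by linarith [hvS.1.2, hr.2]⟩, hn⟩
    rcases le_total r (s + 20 * R) with hle | hle
    · linarith [hu r hrS hle, hr.1]
    · linarith [hv r hrS hle, hr.2]
  have hsub' : Icc (u + 1) (v - 1) ⊆ Icc a b :=
    (Icc_subset_Icc (by linarith [huS.1.1]) (by linarith [hvS.1.2])).trans hsub
  -- Each stretch of length at most `R` has its transient set away from `P`, so the projection moves
  -- by at most `lam ≤ R / 100`. Along an excursion longer than about `10 * R` this is too slow: its
  -- ends are within about `3 * R` of their projections.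
  have hstep : ∀ n : ℕ, ∀ r ∈ Icc (u + 1) (v - 1), r - (u + 1) ≤ n * R →
      dist (g (β (u + 1))) (g (β r)) ≤ n * lam := by
    intro n
    induction n with
    | zero =>
      intro r hr hle
      obtain rfl : r = u + 1 := le_antisymm (by simpa using hle) hr.1
      simp
    | succ n ih =>
      intro r hr hle
      push_cast at hle ⊢
      have hr₁ : max (u + 1) (r - R) ∈ Icc (u + 1) (v - 1) :=
        ⟨le_max_left _ _, max_le (hr.1.trans hr.2) (by linarith [hr.2])⟩
      have hr₂ : max (u + 1) (r - R) ≤ r := max_le hr.1 (by linarith)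
      have hr₃ := le_max_right (u + 1) (r - R)
      have hn : (0 : ℝ) ≤ n * R := mul_nonneg n.cast_nonneg (by linarith)
      have hd₁ := ih _ hr₁ (by
        rw [max_def]; split_ifs <;> linarith)
      have hd₂ := hgc (β (max (u + 1) (r - R))) (β r) fun z hz hn => by
        obtain ⟨q, hq, hzq⟩ := h.path _ (hsub' hr₁) _ (hsub' hr)
          (by rw [abs_sub_comm, abs_of_nonneg (by linarith)]; linarith) z hz
        rw [uIcc_of_le hr₂] at hq
        exact hfar q ⟨hr₁.1.trans hq.1, hq.2.trans hr.2⟩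
          (hn.of_dist_le (r := lam) (by rwa [dist_comm]) (by linarith))
      linarith [dist_triangle (g (β (u + 1))) (g (β (max (u + 1) (r - R)))) (g (β r))]
  have huv : u + 1 ≤ v - 1 := by linarith
  have hu₁ : u + 1 ∈ Icc (u + 1) (v - 1) := ⟨le_rfl, huv⟩
  have hv₁ : v - 1 ∈ Icc (u + 1) (v - 1) := ⟨huv, le_rfl⟩
  have hgd : ∀ r ∈ Icc a b, ∀ r' ∈ Icc a b, |r - r'| ≤ 1 → IsNear (3 * R) P (β r') →
      dist (β r) (g (β r)) ≤ 3 * R + 1 + 2 * lam := fun r hr r' hr' hd hn => by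
    obtain ⟨q, hq, hdq⟩ := hn.of_dist_le (y := β r) (h.upper r hr r' hr') (l := 3 * R + 1 + lam)
      (by linarith)
    linarith [hg (β r) q hq (by linarith)]
  have e₁ := hgd (u + 1) (hsub' hu₁) u (hsub huS.1) (by simp) huS.2
  have e₂ := hgd (v - 1) (hsub' hv₁) v (hsub hvS.1) (by simp) hvS.2
  have hRpos : 0 < R := by linarith
  have e₃ := hstep ⌈(v - 1 - (u + 1)) / R⌉₊ (v - 1) hv₁ (by
    rw [← div_le_iff₀ hRpos]; exact Nat.le_ceil _)
  have e₄ : (⌈(v - 1 - (u + 1)) / R⌉₊ : ℝ) * R ≤ v - 1 - (u + 1) + R := by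
    have := (Nat.ceil_lt_add_one (show 0 ≤ (v - 1 - (u + 1)) / R by
      apply div_nonneg <;> linarith)).le
    calc _ ≤ ((v - 1 - (u + 1)) / R + 1) * R := mul_le_mul_of_nonneg_right this hRpos.le
      _ = _ := by field_simp
  have e₅ : (⌈(v - 1 - (u + 1)) / R⌉₊ : ℝ) * (100 * lam) ≤ ⌈(v - 1 - (u + 1)) / R⌉₊ * R :=
    mul_le_mul_of_nonneg_left hR (Nat.cast_nonneg _)
  have e₆ := h.lower (v - 1) (hsub' hv₁) (u + 1) (hsub' hu₁)
  rw [abs_of_nonneg (by linarith)] at e₆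
  have e₇ := dist_triangle4 (β (u + 1)) (g (β (u + 1))) (g (β (v - 1))) (β (v - 1))
  rw [dist_comm (g (β (v - 1)))] at e₇
  rw [dist_comm] at e₆
  linarith

theorem exists_return_uIcc (h : IsScale Ps tr β a b R lam) {P : Set X} (hP : P ∈ Ps) {s t : ℝ}
    (hs : s ∈ Icc a b) (ht : t ∈ Icc a b) (hst : 20 * R ≤ |t - s|)
    (hns : IsNear (R + 1) P (β s)) (hnt : IsNear (R + 1) P (β t)) :
    ∃ r ∈ Icc a b, 20 * R ≤ |r - s| ∧ |r - s| ≤ 30 * R ∧ IsNear (3 * R) P (β r) := by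
  have h1 := h.one_le
  have hR := h.mul_le
  rcases le_abs'.1 hst with hle | hle
  · obtain ⟨r, hr, h2, h3, h4⟩ := h.reverse.exists_return (s := -s) (t := -t) hP
      ⟨by linarith [hs.2], by linarith [hs.1]⟩ ⟨by linarith [ht.2], by linarith [ht.1]⟩
      (by linarith) (by simpa using hns) (by simpa using hnt)
    refine ⟨-r, ⟨by linarith [hr.2], by linarith [hr.1]⟩, ?_, ?_, h4⟩
    · exact le_abs'.2 (Or.inl (by linarith))
    · exact abs_le.2 ⟨by linarith, by linarith⟩
  · obtain ⟨r, hr, h2, h3, h4⟩ := h.exists_return hP hs ht (by linarith) hns hnt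
    refine ⟨r, hr, le_abs.2 (Or.inl (by linarith)), abs_le.2 ⟨by linarith, by linarith⟩, h4⟩

/-- A point at distance `R` from `β` can be bypassed on one side of a transient path. -/
theorem exists_bypass (h : IsScale Ps tr β a b R lam) {f : ℝ → X} (hf : Continuous f) {c d : ℝ}
    (hcd : c ≤ d) {T : Set X} (hT : IsClosed T)
    (hgap : ∀ s ∈ Icc c d, ∀ t ∈ Icc c d, s ≤ t → (¬ ∃ P ∈ Ps, f s ∈ P ∧ f t ∈ P) →
      ∃ r ∈ Icc s t, f r ∈ T)
    (hnear : ∀ r ∈ Icc c d, f r ∈ T ∪ {f c, f d} → ∃ m ∈ Icc a b, dist (f r) (β m) ≤ R)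
    (hc : ∃ m ∈ Icc a b, f c = β m) (hfar : ∀ m ∈ Icc a b, R ≤ dist (β m) (f d)) :
    ∃ s ∈ Icc c d, ∃ m ∈ Icc a b, dist (β m) (f d) ≤ 100 * R ∧
      ∀ z ∈ tr (f s) (β m), R / 2 ≤ dist z (f d) := by
  have h1 := h.one_le
  have hR := h.mul_le
  set p := f d with hp
  -- A transient point in this annulus is joined to `β` by a piece of length at most `R`, which
  -- cannot come near `p`.
  by_cases hcase : ∃ s ∈ Icc c d, f s ∈ T ∪ {f c} ∧ 2 * R ≤ dist (f s) p ∧ dist (f s) p ≤ 60 * R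
  · obtain ⟨s, hs, hsT, hd₁, hd₂⟩ := hcase
    obtain ⟨m, hm, hdm⟩ := hnear s hs (hsT.imp id (fun h => Or.inl h))
    refine ⟨s, hs, m, hm, by linarith [dist_triangle_left (β m) p (f s)], fun z hz => ?_⟩
    obtain ⟨q, hq, hzq⟩ := h.between (f s) (β m) (by linarith) z hz
    linarith [dist_triangle4 (f s) q z p, dist_comm q z]
  have hcT : f c ∈ T ∪ {f c} := Or.inr rfl
  rcases le_or_gt (dist (f c) p) (60 * R) with hle | hgt
  · obtain ⟨m, hm, hmc⟩ := hc
    refine ⟨c, ⟨le_rfl, hcd⟩, m, hm, by rw [← hmc]; linarith, fun z hz => ?_⟩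
    rw [← hmc] at hz
    obtain ⟨q, hq, hzq⟩ := h.between (f c) (f c) (by rw [dist_self]; linarith) z hz
    rw [dist_self] at hq
    have := hfar m hm
    rw [← hmc] at this
    linarith [dist_triangle4 (f c) q z p, dist_comm q z]
  -- With the annulus empty of transient points, the path must jump from distance `60 * R` to `2 *
  -- R` along one peripheral set `P`.
  have hclosed : IsClosed (T ∪ {f c, p}) := hT.union (Set.toFinite _).isClosed
  obtain ⟨r, hr, hrA, hrB⟩ | ⟨P, hP, s₁, hs₁, s₂, hs₂, hA, hB, hn₁, hn₂⟩ :=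
    exists_gap (Ps := Ps) hf (A := (T ∪ {f c, p}) ∩ {z | 60 * R ≤ dist z p})
      (B := (T ∪ {f c, p}) ∩ closedBall p (2 * R))
      (hclosed.inter (isClosed_le continuous_const (continuous_id.dist continuous_const)))
      (hclosed.inter isClosed_closedBall) hcd
      ⟨Or.inr (Or.inl rfl), hgt.le⟩
      ⟨Or.inr (Or.inr rfl), by rw [mem_closedBall, dist_self]; linarith⟩
      (fun s hs t ht hst hno => by
        obtain ⟨r, hr, hrT⟩ := hgap s hs t ht hst hno
        refine ⟨r, hr, ?_⟩
        by_contra hAB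
        rw [mem_union, not_or] at hAB
        have hA : ¬ 60 * R ≤ dist (f r) p := fun hd => hAB.1 ⟨Or.inl hrT, hd⟩
        have hB : ¬ dist (f r) p ≤ 2 * R := fun hd => hAB.2 ⟨Or.inl hrT, hd⟩
        exact hcase ⟨r, ⟨hs.1.trans hr.1, hr.2.trans ht.2⟩, Or.inl hrT, by linarith, by linarith⟩)
  · have e₁ : 60 * R ≤ dist (f r) p := hrA.2
    have e₂ : dist (f r) p ≤ 2 * R := hrB.2
    linarith
  have e₁ : 60 * R ≤ dist (f s₁) p := hA.2
  have e₂ : dist (f s₂) p ≤ 2 * R := hB.2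
  obtain ⟨m₁, hm₁, hd₁⟩ := hnear s₁ hs₁ hA.1
  obtain ⟨m₂, hm₂, hd₂⟩ := hnear s₂ hs₂ hB.1
  have hlong : 20 * R ≤ |m₁ - m₂| := by
    have := h.upper m₁ hm₁ m₂ hm₂
    linarith [dist_triangle4 (f s₁) (β m₁) (β m₂) (f s₂), dist_comm (β m₂) (f s₂),
      dist_triangle (f s₁) (f s₂) p]
  -- `β` comes near `P` at both ends of the jump, hence also at a moderate distance from `p`. The
  -- connection goes along `P` to `m'`, then briefly to `β m`.
  obtain ⟨m, hm, hl, hu, m', hm', hmm'⟩ := h.exists_return_uIcc hP hm₂ hm₁ hlong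
    (hn₂.of_dist_le (by rwa [dist_comm]) le_rfl) (hn₁.of_dist_le (by rwa [dist_comm]) le_rfl)
  have e₃ := h.upper m hm m₂ hm₂
  have e₄ := h.lower m hm m₂ hm₂
  have e₅ : dist (β m₂) p ≤ 3 * R := by linarith [dist_triangle_left (β m₂) p (f s₂)]
  have e₆ : 16 * R ≤ dist (β m) p := by linarith [dist_triangle_right (β m) (β m₂) p]
  have e₇ : 13 * R ≤ dist m' p := by linarith [dist_triangle (β m) m' p]
  refine ⟨s₁, hs₁, m, hm, by linarith [dist_triangle (β m) (β m₂) p], fun z hz => ?_⟩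
  obtain ⟨w, hw | hw, hzw⟩ := h.thin _ _ m' z hz
  · rcases h.peripheral P hP _ m' hn₁ ⟨m', hm', by simp⟩ w hw with hd | hd
    · linarith [dist_triangle4 (f s₁) w z p, dist_comm w z, dist_comm (f s₁) w]
    · linarith [dist_triangle4 m' w z p, dist_comm w z, dist_comm m' w]
  · rw [dist_comm] at hmm'
    obtain ⟨q, hq, hwq⟩ := h.between m' (β m) (by linarith) w hw
    linarith [dist_triangle4 m' q w p, dist_comm w q, dist_triangle w z p, dist_comm w z]

end IsScale

/-! ### Uniform closeness to almost-geodesics -/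

namespace GuessedGeodesics

variable {X : Type*} [MetricSpace X] {Ps : Set (Set X)} {η : X → X → ℝ → X} {tr : X → X → Set X}
  {E : ℝ}

theorem exists_isScale (h : GuessedGeodesics Ps η tr E) (C : ℝ) :
    ∃ R₀ : ℝ, 1 ≤ R₀ ∧ ∀ R, R₀ ≤ R → ∃ lam, 2 * E ≤ lam ∧ ∀ β a b x y,
      IsAlmostGeodesic 1 C β a b x y → IsScale Ps tr β a b R lam := by
  have hE := h.one_le
  obtain ⟨F, hF0, hF⟩ := h.exists_bound (1 + C)
  obtain ⟨K, hK0, hK⟩ := h.exists_peripheral_bound 1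
  obtain ⟨κ, c, hκ, hgate⟩ := h.exists_isGate
  obtain ⟨c₁, c₂, hc₁, hc₂, hcon⟩ := h.exists_contraction κ c
  set M := 2 * E + F + K + c₁ + c₂ + |C| + |c 0|
  have hC := le_abs_self C
  have hC0 := abs_nonneg C
  have hc := le_abs_self (c 0)
  have hc0 := abs_nonneg (c 0)
  -- The factors 1000 and 100 are those of `IsScale`, with `lam = M * (k + 1)`.
  obtain ⟨R₀, hR₀, hlog⟩ := exists_two_pow_ge_and_mul_le 1000 (100 * M)
  refine ⟨R₀, hR₀, fun R hR => ?_⟩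
  obtain ⟨k, hk1, hk2⟩ := hlog R hR
  have hk : (0 : ℝ) ≤ k := k.cast_nonneg
  have hkE : (0 : ℝ) ≤ k * E := by positivity
  have hMk : (M - E) * k + M = M * (k + 1) - k * E := by ring
  have hMk' : 0 ≤ (M - E) * k := mul_nonneg (by linarith) hk
  have hlam : k * E + M ≤ M * (k + 1) := by linarith
  have step : ∀ β a b x y, IsAlmostGeodesic 1 C β a b x y → ∀ s t, a ≤ s → s ≤ t → t ≤ b →
      |s - t| ≤ 1000 * R → ∀ z ∈ tr (β s) (β t), ∃ r ∈ uIcc s t, dist z (β r) ≤ k * E + F :=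
    fun β a b x y hβ s t has hst htb hd z hz => by
      rw [abs_sub_comm, abs_of_nonneg (by linarith)] at hd
      obtain ⟨r, hr, hzr⟩ := h.dist_almostGeodesic_le_of_bound hF (hβ.restrict has hst htb)
        (hd.trans hk1) hz
      exact ⟨r, by rwa [uIcc_of_le hst], hzr⟩
  refine ⟨M * (k + 1), by linarith, fun β a b x y hβ => ⟨by linarith, by linarith,
    fun s hs t ht => ?_, fun s hs t ht => ?_, fun s hs t ht hd z hz => ?_, fun x y hd z hz => ?_,
    fun x y z w hw => ?_, fun P hP x y hx hy z hz => ?_, fun P hP hne => ?_⟩⟩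
  · have := hβ.lower s hs t ht
    rw [inv_one, one_mul] at this
    linarith
  · have := hβ.upper s hs t ht
    rw [one_mul] at this
    linarith
  · rcases le_total s t with hst | hst
    · obtain ⟨r, hr, hzr⟩ := step β a b x y hβ s t hs.1 hst ht.2 hd z hz
      exact ⟨r, hr, by linarith⟩
    · obtain ⟨w, hw, hzw⟩ := h.symm hz
      obtain ⟨r, hr, hwr⟩ := step β a b x y hβ t s ht.1 hst hs.2 (by rwa [abs_sub_comm]) w hw
      exact ⟨r, by rwa [uIcc_comm], by linarith [dist_triangle z w (β r)]⟩
  · obtain ⟨q, hq1, hq3⟩ := h.exists_between (hd.trans hk1) hz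
    exact ⟨q, hq1, by linarith⟩
  · obtain ⟨w', hw', hd⟩ := h.thin x y z w hw
    exact ⟨w', hw', by linarith⟩
  · exact (hK P hP x y hx hy z hz).imp (fun hd => by linarith) (fun hd => by linarith)
  · choose g hg using hgate P hP hne
    refine ⟨g, fun x q hq hd => ?_, fun x y hno => ?_⟩
    · obtain ⟨w, hw, hwd⟩ := (hg x).2 0 q ⟨q, hq, by simp⟩
      obtain ⟨q', hq1, hq2⟩ := h.exists_between (hd.trans hk1) hw
      linarith [dist_triangle4 x q' w (g x), dist_comm w q', dist_comm w (g x)]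
    · have := hcon P x y _ _ (hg x) (hg y) fun z hz hn => hno z hz (hn.mono (by linarith))
      linarith

/-- Transient sets are close to almost-geodesics. -/
theorem exists_dist_almostGeodesic_le (h : GuessedGeodesics Ps η tr E) (C : ℝ) :
    ∃ L, 0 ≤ L ∧ ∀ β a b x y, IsAlmostGeodesic 1 C β a b x y → ∀ z ∈ tr x y,
      ∃ r ∈ Icc a b, dist z (β r) ≤ L := by
  have hE := h.one_le
  obtain ⟨R₀, hR₀, hscale⟩ := h.exists_isScale C
  refine ⟨R₀, by linarith, fun β a b x y hβ => ?_⟩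
  have hcomp : IsCompact (tr x y) := by
    refine ((isCompact_Icc (a := (0 : ℝ)) (b := 1)).image
      (h.continuous x y)).of_isClosed_subset (h.isClosed x y) ?_
    exact fun z hz => h.exists_param x y z hz
  have hβc : IsCompact (β '' Icc a b) := isCompact_Icc.image_of_continuousOn hβ.continuousOn
  have hβn : (β '' Icc a b).Nonempty := ⟨_, a, ⟨le_rfl, hβ.le⟩, rfl⟩
  have hinf : ∀ z, ∃ r ∈ Icc a b, infDist z (β '' Icc a b) = dist z (β r) := fun z => by
    obtain ⟨_, ⟨r, hr, rfl⟩, hd⟩ := hβc.exists_infDist_eq_dist hβn z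
    exact ⟨r, hr, hd⟩
  obtain ⟨w₀, hw₀, -⟩ := h.left_near x y
  obtain ⟨p, hp, hmax⟩ := hcomp.exists_isMaxOn ⟨w₀, hw₀⟩
    (continuous_infDist_pt (β '' Icc a b)).continuousOn
  set R := infDist p (β '' Icc a b) with hR
  have hnear : ∀ z ∈ tr x y, ∃ r ∈ Icc a b, dist z (β r) ≤ R := fun z hz => by
    obtain ⟨r, hr, hd⟩ := hinf z
    exact ⟨r, hr, hd ▸ hmax hz⟩
  rcases le_or_gt R R₀ with hle | hgt
  · intro z hz
    obtain ⟨r, hr, hd⟩ := hnear z hz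
    exact ⟨r, hr, hd.trans hle⟩
  exfalso
  obtain ⟨lam, hlamE, hsc⟩ := hscale R hgt.le
  have hS := hsc β a b x y hβ
  have hlam := hS.mul_le
  have hfar : ∀ m ∈ Icc a b, R ≤ dist (β m) p := fun m hm => by
    rw [dist_comm]; exact infDist_le_dist_of_mem ⟨m, hm, rfl⟩
  obtain ⟨t, ht, htp⟩ := h.exists_param x y p hp
  have hx : x = β a := hβ.source.symm
  have hy : y = β b := hβ.target.symm
  have ha : a ∈ Icc a b := ⟨le_rfl, hβ.le⟩
  have hb : b ∈ Icc a b := ⟨hβ.le, le_rfl⟩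
  have hRpos : 0 ≤ R := infDist_nonneg
  have hnear' : ∀ z ∈ tr x y ∪ {x, p} ∪ {y}, ∃ m ∈ Icc a b, dist z (β m) ≤ R := by
    rintro z ((hz | rfl | rfl) | rfl)
    · exact hnear z hz
    · exact ⟨a, ha, by rw [← hx, dist_self]; exact hRpos⟩
    · exact hnear _ hp
    · exact ⟨b, hb, by rw [← hy, dist_self]; exact hRpos⟩
  obtain ⟨s₁, hs₁, m₁, hm₁, hd₁, hz₁⟩ := hS.exists_bypass (h.continuous x y) ht.1 (h.isClosed x y)
    (fun s hs s' hs' hss hno => by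
      obtain ⟨r, hr, hrt⟩ := h.exists_of_not_common x y s ⟨hs.1, hs.2.trans ht.2⟩ s'
        ⟨hs'.1, hs'.2.trans ht.2⟩ hno
      exact ⟨r, by rwa [uIcc_of_le hss] at hr, hrt⟩)
    (fun r hr hrT => hnear' _ (Or.inl (by rwa [h.source, htp] at hrT)))
    ⟨a, ha, by rw [h.source, hx]⟩ (by rwa [htp])
  -- The other side of `p`, obtained by running the path backwards.
  obtain ⟨s₂, hs₂, m₂, hm₂, hd₂, hz₂⟩ := hS.exists_bypass (f := fun r => η x y (-r))
    (c := -1) (d := -t)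
    ((h.continuous x y).comp continuous_neg) (by linarith [ht.2]) (h.isClosed x y)
    (fun s hs s' hs' hss hno => by
      obtain ⟨r, hr, hrt⟩ := h.exists_of_not_common x y (-s)
        ⟨by linarith [hs.2, ht.1], by linarith [hs.1]⟩ (-s')
        ⟨by linarith [hs'.2, ht.1], by linarith [hs'.1]⟩ hno
      rw [uIcc_of_ge (by linarith)] at hr
      exact ⟨-r, ⟨by linarith [hr.2], by linarith [hr.1]⟩, by simpa using hrt⟩)
    (fun r hr hrT => by
      simp only [neg_neg, h.target, htp] at hrT
      refine hnear' _ ?_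
      rcases hrT with hrT | hrT | hrT
      · exact Or.inl (Or.inl hrT)
      · exact Or.inr hrT
      · exact Or.inl (Or.inr (Or.inr hrT)))
    ⟨b, hb, by simp only [neg_neg]; rw [h.target, hy]⟩ (by simpa only [neg_neg, htp] using hfar)
  rw [htp] at hd₁ hz₁
  simp only [neg_neg, htp] at hd₂ hz₂
  obtain ⟨w, hw, hpw⟩ := h.suppath x y s₁ ⟨hs₁.1, hs₁.2.trans ht.2⟩ (-s₂)
    ⟨by linarith [hs₂.2, ht.1], by linarith [hs₂.1]⟩ t
    (by rw [uIcc_of_le (by linarith [hs₁.2, hs₂.2])]; exact ⟨hs₁.2, by linarith [hs₂.2]⟩)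
    (by rwa [htp])
  rw [htp] at hpw
  -- Thinness of the quadrilateral puts `p` near one of its three other sides. Two avoid the ball of
  -- radius `R / 2` around `p`; the third is within `lam` of `β`, while `β` stays at distance `R`
  -- from `p`.
  obtain ⟨w₁, hw₁ | hw₁, hd₁'⟩ := h.thin _ _ (β m₁) w hw
  · linarith [hz₁ w₁ hw₁, dist_triangle4 w₁ w p p, dist_self p, dist_comm w w₁, dist_comm w p]
  obtain ⟨w₂, hw₂ | hw₂, hd₂'⟩ := h.thin _ _ (β m₂) w₁ hw₁
  · have hl := hS.lower m₁ hm₁ m₂ hm₂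
    obtain ⟨r, hr, hd⟩ := hS.path m₁ hm₁ m₂ hm₂
      (by linarith [dist_triangle_right (β m₁) (β m₂) p]) w₂ hw₂
    have hr' : r ∈ Icc a b := uIcc_subset_Icc hm₁ hm₂ hr
    linarith [hfar r hr', dist_triangle4 (β r) w₂ w₁ w, dist_triangle (β r) w p, dist_comm w p,
      dist_comm w₂ (β r), dist_comm w₁ w₂, dist_comm w w₁]
  · obtain ⟨w₃, hw₃, hd₃⟩ := h.symm hw₂
    linarith [hz₂ w₃ hw₃, dist_triangle4 w₃ w₂ w₁ w, dist_triangle w₃ w p, dist_comm w p,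
      dist_comm w₂ w₃, dist_comm w₁ w₂, dist_comm w w₁]

end GuessedGeodesics

/-! ### Relative hyperbolicity and transient points -/

theorem exists_isLeast_preimage {X : Type*} [MetricSpace X] {γ : ℝ → X} {a b : ℝ}
    (hγ : ContinuousOn γ (Icc a b)) {S : Set X} (hS : IsClosed S)
    (hne : ∃ t ∈ Icc a b, γ t ∈ S) : ∃ t, IsEntrance γ a b S t :=
  (isCompact_Icc.of_isClosed_subset (hγ.preimage_isClosed_of_isClosed isClosed_Icc hS)
    inter_subset_left).exists_isLeast hne

theorem exists_isGreatest_preimage {X : Type*} [MetricSpace X] {γ : ℝ → X} {a b : ℝ}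
    (hγ : ContinuousOn γ (Icc a b)) {S : Set X} (hS : IsClosed S)
    (hne : ∃ t ∈ Icc a b, γ t ∈ S) : ∃ t, IsExit γ a b S t :=
  (isCompact_Icc.of_isClosed_subset (hγ.preimage_isClosed_of_isClosed isClosed_Icc hS)
    inter_subset_left).exists_isGreatest hne

theorem IsExit.isEntrance_neg {X : Type*} {γ : ℝ → X} {a b t : ℝ} {S : Set X}
    (h : IsExit γ a b S t) : IsEntrance (fun s => γ (-s)) (-b) (-a) S (-t) := by
  refine ⟨⟨⟨by linarith [h.1.1.2], by linarith [h.1.1.1]⟩, by simpa using h.1.2⟩, fun s hs => ?_⟩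
  have := h.2 ⟨⟨by linarith [hs.1.2], by linarith [hs.1.1]⟩, hs.2⟩
  linarith

namespace GuessedGeodesics

variable {X : Type*} [MetricSpace X] {Ps : Set (Set X)} {η : X → X → ℝ → X} {tr : X → X → Set X}
  {E : ℝ}

/-- A coarse nearest point projection to each peripheral set, which contracts the sets
`tr x y` far from it. -/
theorem exists_projection (h : GuessedGeodesics Ps η tr E) :
    ∃ G, 0 ≤ G ∧ ∀ P ∈ Ps, P.Nonempty → ∃ g : X → X,
      (∀ k x, IsNear k P x → dist x (g x) ≤ k + G) ∧
      ∀ x y, (∀ z ∈ tr x y, ¬ IsNear G P z) → dist (g x) (g y) ≤ G := by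
  obtain ⟨κ, c, hκ, hgate⟩ := h.exists_isGate
  obtain ⟨c₁, c₂, hc₁, hc₂, hcon⟩ := h.exists_contraction κ c
  obtain ⟨L, hL, hclose⟩ := h.exists_dist_almostGeodesic_le 0
  have hc := le_abs_self (c 0)
  have hc0 := abs_nonneg (c 0)
  refine ⟨c₁ + c₂ + L + |c 0|, by positivity, fun P hP hne => ?_⟩
  choose g hg using hgate P hP hne
  refine ⟨g, fun k x ⟨q, hq, hxq⟩ => ?_, fun x y hno => ?_⟩
  · obtain ⟨w, hw, hwd⟩ := (hg x).2 0 q ⟨q, hq, by simp⟩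
    obtain ⟨γ, hγ⟩ := h.geodesic x q
    obtain ⟨r, hr, hd⟩ := hclose γ _ _ x q hγ.isAlmostGeodesic w hw
    have := hγ.isometric 0 ⟨le_rfl, dist_nonneg⟩ r hr
    rw [hγ.source, zero_sub, abs_neg, abs_of_nonneg hr.1] at this
    linarith [hr.2, dist_triangle4 x (γ r) w (g x), dist_comm w (γ r), dist_comm w (g x)]
  · have := hcon P x y _ _ (hg x) (hg y) fun z hz hn => hno z hz (hn.mono (by linarith))
    linarith

/-- If a geodesic misses the neighbourhood of `P`, then so does the transient set, and its ends have
close projections. With `ε = 1 / 4` this bounds `dist x y`, so that `x` itself is within `M` of `P`.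
-/
theorem alphaTwo (h : GuessedGeodesics Ps η tr E) : AlphaTwo Ps := by
  obtain ⟨G, hG, hproj⟩ := h.exists_projection
  obtain ⟨L, hL, hclose⟩ := h.exists_dist_almostGeodesic_le 0
  refine ⟨1 / 4, by norm_num, by norm_num, 2 + 2 * G + L, by positivity,
    fun P hP x y hx hy γ hγ => ?_⟩
  have hd : 0 ≤ dist x y := dist_nonneg
  have hx' : IsNear (1 / 4 * dist x y + 1) P x :=
    isNear_of_mem_cthickening hx (by positivity) (by linarith)
  have hy' : IsNear (1 / 4 * dist x y + 1) P y :=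
    isNear_of_mem_cthickening hy (by positivity) (by linarith)
  obtain ⟨g, hg, hgc⟩ := hproj P hP ⟨_, hx'.choose_spec.1⟩
  by_contra! hno
  have hxy := hgc x y fun z hz hn => by
    obtain ⟨r, hr, hzr⟩ := hclose γ _ _ x y hγ.isAlmostGeodesic z hz
    exact hno r hr ((hn.of_dist_le (r := L) (by rwa [dist_comm]) le_rfl).mem_cthickening
      (by linarith))
  have hsmall : dist x y ≤ 4 + 6 * G := by
    linarith [hg _ x hx', hg _ y hy', dist_triangle4 x (g x) (g y) y, dist_comm y (g y)]
  refine hno 0 ⟨le_rfl, hd⟩ ?_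
  rw [hγ.source]
  exact hx'.mem_cthickening (by linarith)

/-- Up to one unit of time before the entrance, the transient set stays away from `P`, so the
projection hardly moves from that of the starting point. -/
theorem dist_entrance_projection_le {C G L σ : ℝ}
    (hclose : ∀ β a b x y, IsAlmostGeodesic 1 C β a b x y → ∀ z ∈ tr x y,
      ∃ r ∈ Icc a b, dist z (β r) ≤ L) (hσ0 : 0 ≤ σ) (hσ : G + L ≤ σ) (hG : 0 ≤ G)
    {P : Set X} {g : X → X}
    (hg : ∀ k x, IsNear k P x → dist x (g x) ≤ k + G)
    (hgc : ∀ x y, (∀ z ∈ tr x y, ¬ IsNear G P z) → dist (g x) (g y) ≤ G)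
    {γ : ℝ → X} {a b t : ℝ} {x y : X} (hγ : IsAlmostGeodesic 1 C γ a b x y)
    (ht : IsEntrance γ a b (cthickening σ P) t) :
    dist (γ t) (g x) ≤ σ + 3 + 2 * C + 2 * G := by
  obtain ⟨⟨htab, htP⟩, hmin⟩ := ht
  set t' := max a (t - 1) with ht'
  have hat' : a ≤ t' := le_max_left _ _
  have ht't : t' ≤ t := max_le htab.1 (by linarith)
  have ht1 : t - 1 ≤ t' := le_max_right _ _
  have hmem : t' ∈ Icc a b := ⟨hat', ht't.trans htab.2⟩
  have hd := hγ.upper t htab t' hmem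
  rw [one_mul, abs_of_nonneg (by linarith)] at hd
  have hn : IsNear (σ + 1) P (γ t) := isNear_of_mem_cthickening htP (by linarith) (by linarith)
  have hn' := hg _ _ (hn.of_dist_le (y := γ t') (r := 1 + C) (by rw [dist_comm]; linarith) le_rfl)
  have hgg : dist (g x) (g (γ t')) ≤ G := by
    rcases le_total a (t - 1) with hle | hle
    · refine hgc _ _ fun z hz hnz => ?_
      have hr' := hγ.restrict le_rfl hat' hmem.2
      rw [hγ.source] at hr'
      obtain ⟨r, hr, hzr⟩ := hclose _ _ _ _ _ hr' z hz
      have := hmin ⟨⟨hr.1, hr.2.trans hmem.2⟩,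
        (hnz.of_dist_le (r := L) (by rwa [dist_comm]) le_rfl).mem_cthickening (by linarith)⟩
      have : t' = t - 1 := max_eq_right hle
      linarith [hr.2]
    · rw [ht', max_eq_left hle, hγ.source, dist_self]; exact hG
  linarith [dist_triangle4 (γ t) (γ t') (g (γ t')) (g x), dist_comm (g x) (g (γ t'))]

theorem isStarAsympTreeGraded (h : GuessedGeodesics Ps η tr E) : IsStarAsympTreeGraded Ps := by
  intro C hC
  have hE := h.one_le
  obtain ⟨G, hG, hproj⟩ := h.exists_projection
  obtain ⟨L, hL, hclose⟩ := h.exists_dist_almostGeodesic_le C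
  set σ := G + L + 2 * E + 3 with hσ
  have hσ0 : 0 ≤ σ := by positivity
  refine ⟨σ, 2 * (σ + 3 + 2 * C + 2 * G), hσ0, by positivity, fun v γ a b hγ => ?_⟩
  have hγ₀ : IsAlmostGeodesic 1 C (γ 0) (a 0) (b 0) (v 0) (v 1) := hγ 0
  have hγ₁ : IsAlmostGeodesic 1 C (γ 1) (a 1) (b 1) (v 1) (v 2) := hγ 1
  have hγ₂ : IsAlmostGeodesic 1 C (γ 2) (a 2) (b 2) (v 2) (v 0) := hγ 2
  set T := tr (v 0) (v 1) ∪ {v 0, v 1}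
  have hT : IsClosed T := (h.isClosed _ _).union (Set.toFinite _).isClosed
  have side₀ : ∀ z ∈ T, ∃ t ∈ Icc (a 0) (b 0), dist z (γ 0 t) ≤ L := by
    rintro z (hz | rfl | rfl)
    · exact hclose _ _ _ _ _ hγ₀ z hz
    · exact ⟨a 0, ⟨le_rfl, hγ₀.le⟩, by rw [hγ₀.source, dist_self]; exact hL⟩
    · exact ⟨b 0, ⟨hγ₀.le, le_rfl⟩, by rw [hγ₀.target, dist_self]; exact hL⟩
  have side : ∀ {β : ℝ → X} {a b : ℝ} {x y z : X}, IsAlmostGeodesic 1 C β a b x y →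
      z ∈ cthickening (2 * E) (tr x y) → ∃ t ∈ Icc a b, dist z (β t) ≤ L + 2 * E + 1 := by
    intro β a b x y z hβ hz
    obtain ⟨w, hw, hzw⟩ := isNear_of_mem_cthickening (l := 2 * E + 1) hz (by linarith) (by linarith)
    obtain ⟨t, ht, hd⟩ := hclose _ _ _ _ _ hβ w hw
    exact ⟨t, ht, by linarith [dist_triangle z w (β t)]⟩
  -- The gap principle applies to the parts of one side that are close to each of the other two: a
  -- common point gives the ball, a jump gives the peripheral set.
  have hcover : tr (v 0) (v 1) ⊆ (T ∩ cthickening (2 * E) (tr (v 2) (v 0))) ∪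
      (T ∩ cthickening (2 * E) (tr (v 1) (v 2))) := fun z hz => by
    obtain ⟨w, hw | hw, hd⟩ := h.thin _ _ (v 2) z hz
    · obtain ⟨w', hw', hd'⟩ := h.symm hw
      exact Or.inl ⟨Or.inl hz, mem_cthickening_of_dist_le _ w' _ _ hw'
        (by linarith [dist_triangle z w w'])⟩
    · obtain ⟨w', hw', hd'⟩ := h.symm hw
      exact Or.inr ⟨Or.inl hz, mem_cthickening_of_dist_le _ w' _ _ hw'
        (by linarith [dist_triangle z w w'])⟩
  have hv₀ : v 0 ∈ T ∩ cthickening (2 * E) (tr (v 2) (v 0)) := by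
    obtain ⟨w, hw, hd⟩ := h.right_near (v 2) (v 0)
    exact ⟨Or.inr (Or.inl rfl), mem_cthickening_of_dist_le _ w _ _ hw (by linarith)⟩
  have hv₁ : v 1 ∈ T ∩ cthickening (2 * E) (tr (v 1) (v 2)) := by
    obtain ⟨w, hw, hd⟩ := h.left_near (v 1) (v 2)
    exact ⟨Or.inr (Or.inr rfl), mem_cthickening_of_dist_le _ w _ _ hw (by linarith)⟩
  obtain ⟨z, hz₁, hz₂⟩ | ⟨P, hP, z, hz, w, hw, hzP, hwP⟩ := h.exists_gap_tr
    (hT.inter isClosed_cthickening) (hT.inter isClosed_cthickening) hv₀ hv₁ hcover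
  · left
    obtain ⟨t₀, ht₀, hd₀⟩ := side₀ z hz₁.1
    obtain ⟨t₁, ht₁, hd₁⟩ := side hγ₁ hz₂.2
    obtain ⟨t₂, ht₂, hd₂⟩ := side hγ₂ hz₁.2
    refine ⟨z, fun i => ?_⟩
    match i with
    | 0 => exact ⟨t₀, ht₀, by rw [mem_closedBall, dist_comm]; linarith⟩
    | 1 => exact ⟨t₁, ht₁, by rw [mem_closedBall, dist_comm]; linarith⟩
    | 2 => exact ⟨t₂, ht₂, by rw [mem_closedBall, dist_comm]; linarith⟩
  right
  obtain ⟨t₀, ht₀, hd₀⟩ := side₀ z hz.1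
  obtain ⟨t₁, ht₁, hd₁⟩ := side hγ₁ hw.2
  obtain ⟨t₂, ht₂, hd₂⟩ := side hγ₂ hz.2
  have hmeet : ∀ i, ∃ t ∈ Icc (a i) (b i), γ i t ∈ cthickening σ P := fun i => by
    match i with
    | 0 => exact ⟨t₀, ht₀, (hzP.of_dist_le ((dist_comm _ _).trans_le hd₀) le_rfl).mem_cthickening
        (by linarith)⟩
    | 1 => exact ⟨t₁, ht₁, (hwP.of_dist_le ((dist_comm _ _).trans_le hd₁) le_rfl).mem_cthickening
        (by linarith)⟩
    | 2 => exact ⟨t₂, ht₂, (hzP.of_dist_le ((dist_comm _ _).trans_le hd₂) le_rfl).mem_cthickening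
        (by linarith)⟩
  obtain ⟨g, hg, hgc⟩ := hproj P hP ⟨_, hzP.choose_spec.1⟩
  choose ent hent using fun i =>
    exists_isLeast_preimage (hγ i).continuousOn isClosed_cthickening (hmeet i)
  choose ext hext using fun i =>
    exists_isGreatest_preimage (hγ i).continuousOn isClosed_cthickening (hmeet i)
  refine ⟨P, hP, ent, ext, hent, hext, fun i => ?_⟩
  -- The exit from one side and the entrance to the next are both compared with the projection of
  -- their common vertex.
  have h₁ := dist_entrance_projection_le hclose hσ0 (by linarith) hG hg hgc (hγ (i + 1))
    (hent (i + 1))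
  have h₂ := dist_entrance_projection_le hclose hσ0 (by linarith) hG hg hgc (hγ i).reverse
    (hext i).isEntrance_neg
  simp only [neg_neg] at h₂
  linarith [dist_triangle_right (γ i (ext i)) (γ (i + 1) (ent (i + 1))) (g (v (i + 1)))]

theorem isHyperbolicRelative (h : GuessedGeodesics Ps η tr E) (h₁ : AlphaOne Ps) :
    IsHyperbolicRelative X Ps :=
  ⟨h.geodesic, h₁, h.alphaTwo, h.isStarAsympTreeGraded⟩

/-- A transient point is near a point of `β` that cannot be deep, because transient sets between
points near `P` are concentrated at the ends. Conversely, a point of `β` far from `tr x y` splits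
`β` in two, and `tr x y` must jump across it along a peripheral set, which makes it deep. -/
theorem exists_hausdorffEDist_transientSet_le (h : GuessedGeodesics Ps η tr E) (C : ℝ) :
    ∃ μ c₀ L : ℝ, 0 ≤ μ ∧ 0 ≤ c₀ ∧ 0 ≤ L ∧
      ∀ c : ℝ, c₀ ≤ c → ∀ (x y : X) (β : ℝ → X) (a b : ℝ), IsAlmostGeodesic 1 C β a b x y →
        hausdorffEDist (tr x y) (transientSet Ps μ c β a b) ≤ ENNReal.ofReal (L + c) := by
  have hE := h.one_le
  obtain ⟨L, hL, hclose⟩ := h.exists_dist_almostGeodesic_le C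
  obtain ⟨K, hK0, hK⟩ := h.exists_peripheral_bound (L + 3)
  have hC := le_abs_self C
  have hC0 := abs_nonneg C
  refine ⟨L + 2, 2 * L + 2 * E + 2 * |C| + K, 3 * L + 3 + 2 * |C| + E, by positivity,
    by positivity, by positivity, fun c hc x y β a b hβ => ?_⟩
  have ha : a ∈ Icc a b := ⟨le_rfl, hβ.le⟩
  have hb : b ∈ Icc a b := ⟨hβ.le, le_rfl⟩
  have conv : ∀ {z w : X}, dist z w ≤ 3 * L + 3 + 2 * |C| + E + c →
      edist z w ≤ ENNReal.ofReal (3 * L + 3 + 2 * |C| + E + c) := fun {z w} hd => by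
    rw [edist_dist]; exact ENNReal.ofReal_le_ofReal hd
  have hup : ∀ s ∈ Icc a b, ∀ t ∈ Icc a b, s ≤ t → dist (β t) (β s) ≤ t - s + |C| :=
    fun s hs t ht hst => by
      have := hβ.upper t ht s hs
      rw [one_mul, abs_of_nonneg (by linarith)] at this
      linarith
  have hlow : ∀ s ∈ Icc a b, ∀ t ∈ Icc a b, s ≤ t → t - s - |C| ≤ dist (β t) (β s) :=
    fun s hs t ht hst => by
      have := hβ.lower t ht s hs
      rw [inv_one, one_mul, abs_of_nonneg (by linarith)] at this
      linarith
  apply hausdorffEDist_le_of_mem_edist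
  · intro p hp
    obtain ⟨t₀, ht₀, hpt⟩ := hclose β a b x y hβ p hp
    refine ⟨β t₀, ⟨⟨t₀, ht₀, rfl⟩, ?_⟩, conv (by linarith)⟩
    rintro ⟨P, hP, s, t, u, has, hst, htu, hub, heq, hsP, huP, hds, hdu⟩
    rw [← heq] at hpt hds hdu
    have hs : s ∈ Icc a b := ⟨has, hst.trans (htu.trans hub)⟩
    have ht : t ∈ Icc a b := ⟨has.trans hst, htu.trans hub⟩
    have hu : u ∈ Icc a b := ⟨has.trans (hst.trans htu), hub⟩
    have r₁ := hβ.restrict le_rfl has hs.2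
    have r₂ := hβ.restrict hu.1 hub le_rfl
    rw [hβ.source] at r₁
    rw [hβ.target] at r₂
    -- In the polygon `x`, `β s`, `β u`, `y` every side through which `p` could pass brings `β t`
    -- within `c₀` of `β s` or `β u`.
    obtain ⟨w, hw | hw, hd⟩ := h.thin x y (β s) p hp
    · obtain ⟨r, hr, hwr⟩ := hclose _ _ _ _ _ r₁ w hw
      have hrm : r ∈ Icc a b := ⟨hr.1, hr.2.trans hs.2⟩
      linarith [hlow r hrm t ht (hr.2.trans hst), hup s hs t ht hst, hr.2,
        dist_triangle4 (β t) p w (β r), dist_comm p (β t)]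
    obtain ⟨w', hw' | hw', hd'⟩ := h.thin (β s) y (β u) w hw
    · rcases hK P hP _ _ (isNear_of_mem_cthickening hsP (by linarith) (by linarith))
        (isNear_of_mem_cthickening huP (by linarith) (by linarith)) w' hw' with hd'' | hd''
      · linarith [dist_triangle4 (β t) p w w', dist_comm p (β t), dist_triangle (β t) w' (β s)]
      · linarith [dist_triangle4 (β t) p w w', dist_comm p (β t), dist_triangle (β t) w' (β u)]
    · obtain ⟨r, hr, hwr⟩ := hclose _ _ _ _ _ r₂ w' hw'
      have hrm : r ∈ Icc a b := ⟨hu.1.trans hr.1, hr.2⟩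
      linarith [hlow t ht r hrm (htu.trans hr.1), hup t ht u hu htu, hr.1,
        dist_triangle4 (β t) p w w', dist_triangle (β t) w' (β r), dist_comm p (β t),
        dist_comm (β t) (β r), dist_comm (β t) (β u)]
  · rintro _ ⟨⟨t, ht, rfl⟩, hnd⟩
    by_contra! hno
    have hfar : ∀ w ∈ tr x y, 3 * L + 3 + 2 * |C| + E + c < dist (β t) w := fun w hw => by
      by_contra! hle
      exact absurd (conv hle) (not_le.2 (hno w hw))
    set T := tr x y ∪ {x, y}
    have hT : IsClosed T := (h.isClosed _ _).union (Set.toFinite _).isClosed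
    have hfarT : ∀ z ∈ T, 3 * L + 3 + 2 * |C| + c < dist (β t) z := by
      rintro z (hz | rfl | rfl)
      · linarith [hfar z hz]
      · obtain ⟨w, hw, hd⟩ := h.left_near z y
        linarith [hfar w hw, dist_triangle (β t) z w]
      · obtain ⟨w, hw, hd⟩ := h.right_near x z
        linarith [hfar w hw, dist_triangle (β t) z w]
    have near : ∀ {I : Set ℝ} {z : X}, z ∈ cthickening L (β '' I) →
        ∃ r ∈ I, dist z (β r) ≤ L + 1 := fun {I z} hz => by
      obtain ⟨_, ⟨r, hr, rfl⟩, hd⟩ :=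
        isNear_of_mem_cthickening (l := L + 1) hz (by linarith) (by linarith)
      exact ⟨r, hr, hd⟩
    obtain ⟨z, hz₁, hz₂⟩ | ⟨P, hP, z, hz, w, hw, hzP, hwP⟩ := h.exists_gap_tr (x := x) (y := y)
      (A := T ∩ cthickening L (β '' Icc a t)) (B := T ∩ cthickening L (β '' Icc t b))
      (hT.inter isClosed_cthickening) (hT.inter isClosed_cthickening)
      ⟨Or.inr (Or.inl rfl), mem_cthickening_of_dist_le _ x _ _
        ⟨a, ⟨le_rfl, ht.1⟩, hβ.source⟩ (by rwa [dist_self])⟩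
      ⟨Or.inr (Or.inr rfl), mem_cthickening_of_dist_le _ y _ _
        ⟨b, ⟨ht.2, le_rfl⟩, hβ.target⟩ (by rwa [dist_self])⟩
      (fun z hz => by
        obtain ⟨r, hr, hd⟩ := hclose _ _ _ _ _ hβ z hz
        rcases le_total r t with hrt | hrt
        · exact Or.inl ⟨Or.inl hz, mem_cthickening_of_dist_le _ _ _ _ ⟨r, ⟨hr.1, hrt⟩, rfl⟩ hd⟩
        · exact Or.inr ⟨Or.inl hz, mem_cthickening_of_dist_le _ _ _ _ ⟨r, ⟨hrt, hr.2⟩, rfl⟩ hd⟩)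
    -- If `z` is close to both halves, then `r₂ - r₁` is small and `β t`, lying between, is close to
    -- `z`.
    · obtain ⟨r₁, hr₁, hd₁⟩ := near hz₁.2
      obtain ⟨r₂, hr₂, hd₂⟩ := near hz₂.2
      have hm₁ : r₁ ∈ Icc a b := ⟨hr₁.1, hr₁.2.trans ht.2⟩
      have hm₂ : r₂ ∈ Icc a b := ⟨ht.1.trans hr₂.1, hr₂.2⟩
      linarith [hlow r₁ hm₁ r₂ hm₂ (hr₁.2.trans hr₂.1), hup r₁ hm₁ t ht hr₁.2, hr₂.1,
        dist_triangle_left (β r₂) (β r₁) z, dist_triangle_right (β t) z (β r₁), hfarT z hz₁.1]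
    · obtain ⟨r₁, hr₁, hd₁⟩ := near hz.2
      obtain ⟨r₂, hr₂, hd₂⟩ := near hw.2
      refine hnd ⟨P, hP, r₁, t, r₂, hr₁.1, hr₁.2, hr₂.1, hr₂.2, rfl,
        (hzP.of_dist_le ((dist_comm _ _).trans_le hd₁) le_rfl).mem_cthickening (by linarith),
        (hwP.of_dist_le ((dist_comm _ _).trans_le hd₂) le_rfl).mem_cthickening (by linarith), ?_, ?_⟩
      · linarith [hfarT z hz.1, dist_triangle_right (β t) z (β r₁)]
      · linarith [hfarT w hw.1, dist_triangle_right (β t) w (β r₂)]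

end GuessedGeodesics

theorem mainTheorem1 {X : Type*} [MetricSpace X] (hX : IsGeodesicSpace X) (Ps : Set (Set X))
    (η : ∀ x y : X, Path x y) (tr : X → X → Set X)
    (tr_closed : ∀ x y, IsClosed (tr x y)) (tr_subset : ∀ x y, tr x y ⊆ range (η x y))
    (D : ℝ)
    (h1 : ∀ x y, dist x y ≤ 2 → ediam (tr x y) ≤ ENNReal.ofReal D)
    (h2 : ∀ x y, ∀ s t : unitInterval,
      hausdorffEDist (tr (η x y s) (η x y t))
        ((tr x y ∩ η x y '' uIcc s t) ∪ {η x y s, η x y t}) ≤ ENNReal.ofReal D)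
    (h3 : ∀ x y z, tr x y ⊆ cthickening D (tr x z ∪ tr z y))
    (h4 : ∀ x y, ∀ s t : unitInterval, (¬ ∃ P ∈ Ps, η x y s ∈ P ∧ η x y t ∈ P) →
      ∃ z ∈ tr x y, z ∈ η x y '' uIcc s t)
    (h5 : AlphaOne Ps)
    (h6 : ∀ k : ℝ, ∃ K : ℝ, ∀ P ∈ Ps, ∀ x y,
      x ∈ cthickening k P → y ∈ cthickening k P → K ≤ dist x y →
      tr x y ⊆ closedBall x K ∪ closedBall y K ∧ ∃ z ∈ tr x y, z ∈ cthickening D P) :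
    IsHyperbolicRelative X Ps ∧
    ∀ C : ℝ, ∃ μ c₀ L : ℝ, 0 ≤ μ ∧ 0 ≤ c₀ ∧ 0 ≤ L ∧
      ∀ c : ℝ, c₀ ≤ c → ∀ (x y : X) (β : ℝ → X) (a b : ℝ), IsAlmostGeodesic 1 C β a b x y →
        hausdorffEDist (tr x y) (transientSet Ps μ c β a b) ≤ ENNReal.ofReal (L + c) := by
  have h := GuessedGeodesics.of_path hX Ps η tr tr_closed tr_subset D h1 h2 h3 h4 h5 h6
  exact ⟨h.isHyperbolicRelative h5, h.exists_hausdorffEDist_transientSet_le⟩
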